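/- Let $\kappa>0$. Let $\mathcal B$ be the space of functions $f$ on $\mathbb R^2$ of the form $f(\alpha,\beta)=\frac1{2\pi}\int \hat f(u,v)\,e^{-i(\alpha u+\beta v)}\,du\,dv$ with $\hat f\in C_c^\infty(\mathbb R^2)$, with the $\kappa$-star product $$(f*g)(\alpha,\beta)=\frac1{2\pi}\int dv\int du\; f(\alpha+u,\beta)\,g(\alpha,e^{-v/\kappa}\beta)\,e^{-iuv}$$ (iterated integral, $u$ innermost). Let $$(T_\gamma f)(\alpha,\beta)=\frac1{2\pi}\int dp\int ds\; f(s,\beta)\,e^{-\gamma p}e^{-ip(s-\alpha)}$$ ($s$ innermost; equivalently $\widehat{T_\gamma f}(u,v)=e^{\gamma u}\hat f(u,v)$), and put $P f=\partial f/\partial\beta$, $\mathcal E^{\pm1}=T_{\pm1/\kappa}$. Let $\Omega^*(\mathcal B)$ be the algebra of forms generated over $\mathcal B$ by anticommuting one-forms $dx,\psi_+,\psi_-$; it is free as a right $\mathcal B$-module on the ordered products of these generators, and the left action is given by $$\begin{aligned} f\,dx&=dx\,f+\psi_-\,\tfrac i\kappa (Pf),\\ f\,\psi_+&=\psi_+\,(\mathcal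 E^{-1}f)+dx\,\tfrac{2i}\kappa(\mathcal E^{-1}Pf)-\psi_-\,\tfrac1{\kappa^2}(\mathcal E^{-1}P^2f),\\ f\,\psi_-&=\psi_-\,(\mathcal Ef).\end{aligned}$$ The exterior derivative is $$df=dx\,(\mathcal E^{-1}Pf)-\tfrac{i\kappa}2\,\psi_+\,\big((\mathcal E^{-1}-1)f\big)+\tfrac12\,\psi_-\,\big((\tfrac i\kappa\mathcal E^{-1}P^2+i\kappa(\mathcal E-1))f\big),$$ extended to forms by $d(e_I f)=(-1)^{|I|}e_I\wedge df$ for each ordered product $e_I$ of $|I|$ generators. Extend $T_\gamma$ to forms coefficientwise, so that it fixes the generators. Let $\int(dx\wedge\psi_+\wedge\psi_-)f=\int_{\mathbb R^2}f\,d\alpha\,d\beta$ (Lebesgue integral). Then: 1. $(\mathcal B,*)$ is an associative algebra and $T_{1/\kappa}$ is an automorphism of it. 2. $\int$ is a closed graded twisted trace: every $f\in\mathcal B$ is Lebesgue integrable, $\int d\rho=0$ for every two-form $\rho$, and $\int\omega\wedge\eta=(-1)^{kl}\int T_{1/\kappa}(\eta)\wedge\omega$ for $\omega\in\Omega^k(\mathcal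 B)$, $\eta\in\Omega^l(\mathcal B)$, $k+l=3$. 3. The functional $\phi(f_0,f_1,f_2,f_3)=\int f_0\,df_1\wedge df_2\wedge df_3$ is a $T_{1/\kappa}$-twisted cyclic $3$-cocycle on $(\mathcal B,*)$: it is multilinear and, for all $f_0,\dots,f_4\in\mathcal B$, $$\phi(f_0,f_1,f_2,f_3)=-\,\phi(T_{1/\kappa}f_3,f_0,f_1,f_2),$$ $$\begin{aligned}&\phi(f_0*f_1,f_2,f_3,f_4)-\phi(f_0,f_1*f_2,f_3,f_4)+\phi(f_0,f_1,f_2*f_3,f_4)\\&\quad-\phi(f_0,f_1,f_2,f_3*f_4)+\phi(T_{1/\kappa}(f_4)*f_0,f_1,f_2,f_3)=0.\end{aligned}$$ -/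

import Mathlib

noncomputable section

namespace KappaMinkowski

/-- Complex functions of the two real coordinates `(α, β)`. -/
abbrev Fn : Type := ℝ × ℝ → ℂ

/-! ### The algebra -/

/-- The Fourier transform on the plane,
`(α, β) ↦ (1 / 2π) ∫ φ(u, v) exp (-i (α u + β v)) du dv`. -/
def fourier (φ : Fn) : Fn := fun p =>
  (1 / (2 * Real.pi) : ℂ) *
    ∫ q : ℝ × ℝ, φ q * Complex.exp (-Complex.I * (p.1 * q.1 + p.2 * q.2))

theorem integrable_fourier {φ : Fn} (h : ContDiff ℝ (⊤ : ℕ∞) φ) (hc : HasCompactSupport φ)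
    (p : ℝ × ℝ) : MeasureTheory.Integrable
      (fun q : ℝ × ℝ => φ q * Complex.exp (-Complex.I * (p.1 * q.1 + p.2 * q.2))) := by
  refine Continuous.integrable_of_hasCompactSupport ?_ hc.mul_right
  exact h.continuous.mul (by fun_prop)

/-- The space `B` of Fourier transforms of smooth functions with compact support. -/
def B : Submodule ℂ Fn where
  carrier := {f | ∃ φ : Fn, ContDiff ℝ (⊤ : ℕ∞) φ ∧ HasCompactSupport φ ∧ f = fourier φ}
  zero_mem' := ⟨0, contDiff_const, HasCompactSupport.zero, by ext p; simp [fourier]⟩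
  add_mem' := by
    rintro _ _ ⟨φ, h, hc, rfl⟩ ⟨ψ, h', hc', rfl⟩
    refine ⟨φ + ψ, h.add h', hc.add hc', ?_⟩
    ext p
    simp only [fourier, Pi.add_apply, add_mul]
    rw [MeasureTheory.integral_add (integrable_fourier h hc p) (integrable_fourier h' hc' p),
      mul_add]
  smul_mem' := by
    rintro c _ ⟨φ, h, hc, rfl⟩
    refine ⟨c • φ, contDiff_const.smul h, hc.mul_left (f := fun _ => c), ?_⟩
    ext p
    simp only [fourier, Pi.smul_apply, smul_eq_mul, mul_assoc]
    rw [MeasureTheory.integral_const_mul]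
    ring

/-- The star product
`(f * g)(α, β) = (1 / 2π) ∫ dv ∫ du f(α + u, β) g(α, exp (-v / κ) β) exp (-i u v)`,
an iterated integral with `u` innermost. -/
def starMul (κ : ℝ) (f g : Fn) : Fn := fun p =>
  (1 / (2 * Real.pi) : ℂ) *
    ∫ v : ℝ, ∫ u : ℝ, f (p.1 + u, p.2) * g (p.1, Real.exp (-v / κ) * p.2) *
      Complex.exp (-Complex.I * (u * v))

/-- The operator `T γ`,
`(T γ f)(α, β) = (1 / 2π) ∫ dp ∫ ds f(s, β) exp (-γ p) exp (-i p (s - α))`, an iterated integral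
with `s` innermost. If `f` is the Fourier transform of `φ(u, v)`, then `T γ f` is the Fourier
transform of `exp (γ u) φ(u, v)`; formally, `(T γ f)(α, β) = f(α + i γ, β)`. -/
def T (γ : ℝ) (f : Fn) : Fn := fun x =>
  (1 / (2 * Real.pi) : ℂ) *
    ∫ p : ℝ, ∫ s : ℝ, f (s, x.2) * Real.exp (-γ * p) * Complex.exp (-Complex.I * (p * (s - x.1)))

/-- The action of the momentum generator `P`: the derivative in the second variable. -/
def P (f : Fn) : Fn := fun x => deriv (fun b : ℝ => f (x.1, b)) x.2

/-- The action of the group-like generator `ℰ`. -/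
def E (κ : ℝ) (f : Fn) : Fn := T (1 / κ) f

/-- The action of the inverse of `ℰ`. -/
def Einv (κ : ℝ) (f : Fn) : Fn := T (-(1 / κ)) f

/-! ### The differential algebra

The generating one-forms `e 0 = dx`, `e 1 = ψ₊`, `e 2 = ψ₋` anticommute, and a form is written
uniquely as `∑ I, e I · ω I` with coefficients on the right, where `e I` is the product of
the `e i`, `i ∈ I`, in increasing order. -/

/-- Forms, given by their right coefficients. -/
abbrev Form : Type := Finset (Fin 3) → Fn

/-- The forms of degree `k` with coefficients in `B`. -/
def IsForm (k : ℕ) (ω : Form) : Prop :=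
  ∀ I, ω I ∈ B ∧ (I.card ≠ k → ω I = 0)

/-- A function as a form of degree `0`. -/
def ofFn (f : Fn) : Form := Pi.single ∅ f

/-- The bimodule rules: `f · e j = ∑ i, e i · (bimod κ f i j)`, that is
`f dx = dx f + ψ₋ (i/κ) P f`,
`f ψ₊ = ψ₊ ℰ⁻¹ f + dx (2i/κ) ℰ⁻¹ P f - ψ₋ (1/κ²) ℰ⁻¹ P² f`,
`f ψ₋ = ψ₋ ℰ f`. -/
def bimod (κ : ℝ) (f : Fn) : Matrix (Fin 3) (Fin 3) Fn :=
  !![f, (2 * Complex.I / κ) • Einv κ (P f), 0;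
     0, Einv κ f, 0;
     (Complex.I / κ) • P f, (-(1 / (κ : ℂ) ^ 2)) • Einv κ (P (P f)), E κ f]

/-- The components of `df = dx (∂₀ f) + ψ₊ (∂₁ f) + ψ₋ (∂₂ f)`. -/
def dComp (κ : ℝ) (f : Fn) : Fin 3 → Fn :=
  ![Einv κ (P f),
    (-(Complex.I * (κ / 2))) • (Einv κ f - f),
    (1 / 2 : ℂ) • ((Complex.I / κ) • Einv κ (P (P f)) + (Complex.I * κ) • (E κ f - f))]

/-- Left multiplication `ω ↦ e i ∧ ω` by a generating one-form. -/
def genWedge (i : Fin 3) (ω : Form) : Form := fun K =>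
  if i ∈ K then ((-1 : ℂ) ^ (K.filter (· < i)).card) • ω (K.erase i) else 0

/-- The product `e i₁ ∧ ⋯ ∧ e iₚ ∧ ω`. -/
def listWedge (l : List (Fin 3)) (ω : Form) : Form := l.foldr genWedge ω

/-- The product `f · (e j₁ ∧ ⋯ ∧ e jₚ) g`, where `f` is moved to the right through one generator
after the other by the bimodule rules. -/
def leftMulList (κ : ℝ) : List (Fin 3) → Fn → Fn → Form
  | [], f, g => ofFn (starMul κ f g)
  | j :: l, f, g => ∑ i : Fin 3, genWedge i (leftMulList κ l (bimod κ f i j) g)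

/-- The left action `f · ω` of functions on forms. -/
def leftMul (κ : ℝ) (f : Fn) (ω : Form) : Form :=
  ∑ J : Finset (Fin 3), leftMulList κ (J.sort (· ≤ ·)) f (ω J)

/-- The product of forms: `(∑ I, e I · ω I) ∧ η = ∑ I, e I ∧ (ω I · η)`. -/
def wedge (κ : ℝ) (ω η : Form) : Form :=
  ∑ I : Finset (Fin 3), listWedge (I.sort (· ≤ ·)) (leftMul κ (ω I) η)

/-- The exterior derivative: `d (∑ I, e I · ω I) = ∑ I, (-1) ^ |I| e I ∧ d (ω I)`. -/
def d (κ : ℝ) (ω : Form) : Form :=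
  ∑ I : Finset (Fin 3), ((-1 : ℂ) ^ I.card) •
    listWedge (I.sort (· ≤ ·)) (∑ i : Fin 3, genWedge i (ofFn (dComp κ (ω I) i)))

/-- The integral of a form: the Lebesgue integral of its coefficient at `dx ∧ ψ₊ ∧ ψ₋`. -/
def integral (ω : Form) : ℂ := ∫ x : ℝ × ℝ, ω Finset.univ x

/-- The automorphism `T (1/κ)` on forms; it fixes the generating one-forms. -/
def twist (κ : ℝ) (ω : Form) : Form := fun I => T (1 / κ) (ω I)

/-- The integral is a closed graded twisted trace on the forms over `B`. -/
structure IsClosedGradedTwistedTrace (κ : ℝ) : Prop where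
  integrable : ∀ f ∈ B, MeasureTheory.Integrable f
  closed : ∀ ω, IsForm 2 ω → integral (d κ ω) = 0
  trace : ∀ k l ω η, k + l = 3 → IsForm k ω → IsForm l η →
    integral (wedge κ ω η) = (-1) ^ (k * l) * integral (wedge κ (twist κ η) ω)

/-- The functional `φ(f₀, f₁, f₂, f₃) = ∫ f₀ df₁ ∧ df₂ ∧ df₃`. -/
def cochain (κ : ℝ) (f : Fin 4 → Fn) : ℂ :=
  integral (wedge κ (wedge κ (leftMul κ (f 0) (d κ (ofFn (f 1)))) (d κ (ofFn (f 2))))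
    (d κ (ofFn (f 3))))

/-! ### Algebras, automorphisms, twisted cyclic cocycles

`A` is a linear subspace of a complex vector space `V`. -/

section Cocycle

/-- `A` is an associative algebra, in general without unit, with the product `mul`. -/
structure IsAlgebraOn {V : Type*} [AddCommGroup V] [Module ℂ V] (A : Submodule ℂ V)
    (mul : V → V → V) : Prop where
  mul_mem : ∀ a ∈ A, ∀ b ∈ A, mul a b ∈ A
  assoc : ∀ a ∈ A, ∀ b ∈ A, ∀ c ∈ A, mul (mul a b) c = mul a (mul b c)
  add_mul : ∀ a ∈ A, ∀ b ∈ A, ∀ c ∈ A, mul (a + b) c = mul a c + mul b c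
  mul_add : ∀ a ∈ A, ∀ b ∈ A, ∀ c ∈ A, mul a (b + c) = mul a b + mul a c
  smul_mul : ∀ (r : ℂ), ∀ a ∈ A, ∀ b ∈ A, mul (r • a) b = r • mul a b
  mul_smul : ∀ (r : ℂ), ∀ a ∈ A, ∀ b ∈ A, mul a (r • b) = r • mul a b

/-- `σ` restricts to an automorphism of the algebra `A`. -/
structure IsAutomorphismOn {V : Type*} [AddCommGroup V] [Module ℂ V] (A : Submodule ℂ V)
    (mul : V → V → V) (σ : V → V) : Prop where
  bijOn : Set.BijOn σ A A
  map_add : ∀ a ∈ A, ∀ b ∈ A, σ (a + b) = σ a + σ b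
  map_smul : ∀ (r : ℂ), ∀ a ∈ A, σ (r • a) = r • σ a
  map_mul : ∀ a ∈ A, ∀ b ∈ A, σ (mul a b) = mul (σ a) (σ b)

/-- The twisted Hochschild coboundary of an `n`-cochain,
`(b φ)(a₀, …, aₙ₊₁) = ∑ i ≤ n, (-1)ⁱ φ(a₀, …, aᵢ aᵢ₊₁, …, aₙ₊₁)
  + (-1)ⁿ⁺¹ φ(σ(aₙ₊₁) a₀, a₁, …, aₙ)`. -/
def twistedCoboundary {V : Type*} (mul : V → V → V) (σ : V → V) (n : ℕ)
    (φ : (Fin (n + 1) → V) → ℂ) (a : Fin (n + 2) → V) : ℂ :=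
  ∑ i : Fin (n + 1), (-1) ^ (i : ℕ) * φ (Fin.contractNth i.castSucc mul a) +
    (-1) ^ (n + 1) * φ (Fin.cons (mul (σ (a (Fin.last (n + 1)))) (a 0))
      (fun i : Fin n => a i.succ.castSucc))

/-- `φ` is a `σ`-twisted cyclic `n`-cocycle on the algebra `A`: it is multilinear,
`φ(a₀, …, aₙ) = (-1)ⁿ φ(σ(aₙ), a₀, …, aₙ₋₁)`, and its twisted Hochschild coboundary vanishes. -/
structure IsTwistedCyclicCocycle {V : Type*} [AddCommGroup V] [Module ℂ V] (A : Submodule ℂ V)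
    (mul : V → V → V) (σ : V → V) (n : ℕ) (φ : (Fin (n + 1) → V) → ℂ) : Prop where
  map_add : ∀ a : Fin (n + 1) → V, (∀ i, a i ∈ A) → ∀ i, ∀ x ∈ A, ∀ y ∈ A,
    φ (Function.update a i (x + y)) = φ (Function.update a i x) + φ (Function.update a i y)
  map_smul : ∀ a : Fin (n + 1) → V, (∀ i, a i ∈ A) → ∀ i, ∀ (r : ℂ), ∀ x ∈ A,
    φ (Function.update a i (r • x)) = r * φ (Function.update a i x)
  cyclic : ∀ a : Fin (n + 1) → V, (∀ i, a i ∈ A) →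
    φ a = (-1) ^ n * φ (Fin.cons (σ (a (Fin.last n))) (fun i : Fin n => a i.castSucc))
  coboundary : ∀ a : Fin (n + 2) → V, (∀ i, a i ∈ A) → twistedCoboundary mul σ n φ a = 0

end Cocycle

end KappaMinkowski

end

noncomputable section

namespace KappaMinkowski

open MeasureTheory Complex

/-! ### Integrals of smooth functions with compact support -/

/-! Everything is pulled back along the Fourier transform from `B` to test functions on the plane,
read as the affine group of the line with multiplication (u, b)(u', b') = (u + u', b + exp(u/κ) b').
There the star product is group convolution (`starMul_fourier`, `conv_assoc`). The operator `T γ` is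
multiplication by the character exp(γu), `P` is multiplication by -iv, and the Lebesgue integral is
2π times evaluation at the identity (`T_fourier`, `P_fourier`, `integral_fourier`). Since v is
additive up to the twist exp(u/κ), `P` is a twisted derivation; since exp(u/κ) is also the Jacobian
factor in group inversion, evaluation at the identity is a twisted trace. These facts are the axioms
of `KappaCalculus`, and the rest is algebra over that structure.

The bimodule rules form a matrix `M` of commuting operators, polynomial in `E`, `Einv` and `P`. It
is multiplicative (`M_mul`), so the left action is a module structure and the wedge product is
associative. The partial derivatives satisfy a Leibniz rule twisted by the same matrix
(`partialD_mul`) and commute with each other and with `M`; hence d is a graded derivation on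
products by functions and d² = 0. The trace annihilates the partial derivatives, so the integral is
closed. Its twisted trace property is checked on words in the generators in bidegrees (0, 3) and (1,
2); the other bidegrees follow from invariance of the integral under `E`.

Cyclicity is then Stokes' formula together with the trace property in bidegree (2, 1). The
Hochschild identity is a telescoping Leibniz expansion whose two end terms cancel by the trace
property in bidegree (3, 0). Transfer back to `B` uses only that the Fourier transform is linear,
onto `B`, and compatible with the operations; injectivity plays no role. -/

theorem hasCompactSupport_marginal {X Y : Type*} [TopologicalSpace X] [TopologicalSpace Y]
    [MeasureSpace Y] [R1Space X] {H : X × Y → ℂ} (hc : HasCompactSupport H) :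
    HasCompactSupport fun x => ∫ y, H (x, y) := by
  refine HasCompactSupport.intro (hc.isCompact.image continuous_fst) fun x hx => ?_
  have : ∀ y, H (x, y) = 0 := fun y => by
    by_contra h
    exact hx ⟨(x, y), subset_tsupport _ h, rfl⟩
  simp [this]

/-- The marginal is the convolution, with parameter x, of the constant 1 with y ↦ H(x, -y),
evaluated at 0; smoothness in the parameter is then a property of convolutions. -/
theorem contDiff_marginal {X Y : Type*} [NormedAddCommGroup X] [NormedSpace ℝ X]
    [NormedAddCommGroup Y] [NormedSpace ℝ Y] [MeasureSpace Y] [BorelSpace Y]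
    [IsLocallyFiniteMeasure (volume : Measure Y)] [(volume : Measure Y).IsNegInvariant]
    {H : X × Y → ℂ} (h : ContDiff ℝ (⊤ : ℕ∞) H) (hc : HasCompactSupport H) :
    ContDiff ℝ (⊤ : ℕ∞) fun x => ∫ y, H (x, y) := by
  have hk : IsCompact ((fun q : X × Y => -q.2) '' tsupport H) :=
    hc.isCompact.image (by fun_prop)
  have key := contDiffOn_convolution_right_with_param (μ := (volume : Measure Y)) (𝕜 := ℝ)
    (f := fun _ : Y => (1 : ℂ)) (n := ⊤) (ContinuousLinearMap.mul ℝ ℂ)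
    (g := fun x y => H (x, -y)) (s := Set.univ) isOpen_univ hk
    (fun x y _ hy => by
      by_contra hne
      exact hy ⟨(x, -y), subset_tsupport _ hne, by simp⟩)
    (locallyIntegrable_const _)
    (by
      apply ContDiff.contDiffOn
      exact h.comp (contDiff_fst.prodMk contDiff_snd.neg))
  have key2 : ContDiff ℝ (⊤ : ℕ∞) _ := contDiffOn_univ.1 (by simpa using key)
  have := key2.comp (contDiff_id.prodMk (contDiff_const (c := (0 : Y))) : ContDiff ℝ (⊤ : ℕ∞)
    fun x : X => (x, (0 : Y)))
  simpa [convolution, Function.comp_def] using this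

theorem hasCompactSupport_tensor {X Y : Type*} [TopologicalSpace X] [TopologicalSpace Y]
    [R1Space X] [R1Space Y] {f : X → ℂ} {g : Y → ℂ} (hf : HasCompactSupport f)
    (hg : HasCompactSupport g) : HasCompactSupport fun q : X × Y => f q.1 * g q.2 := by
  refine HasCompactSupport.intro (hf.isCompact.prod hg.isCompact) fun q hq => ?_
  by_contra h
  exact hq ⟨subset_tsupport _ (left_ne_zero_of_mul h), subset_tsupport _ (right_ne_zero_of_mul h)⟩

/-- Fourier inversion on the line for smooth functions with compact support. -/
theorem fourier_inversion_line {h : ℝ → ℂ} (hh : ContDiff ℝ (⊤ : ℕ∞) h)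
    (hc : HasCompactSupport h) (x : ℝ) :
    ∫ s : ℝ, ((1 / (2 * Real.pi) : ℂ) * ∫ u : ℝ, h u * cexp (-I * (s * u))) * cexp (I * (s * x))
      = h x := by
  set S : SchwartzMap ℝ ℂ := hc.toSchwartzMap hh
  have hS : (S : ℝ → ℂ) = h := rfl
  have hF : Integrable (FourierTransform.fourier h) := by
    rw [← hS, ← SchwartzMap.fourier_coe]
    exact SchwartzMap.integrable _
  have inv := (hS ▸ S.integrable : Integrable h).fourierInv_fourier_eq hF
    (v := x) hh.continuous.continuousAt
  rw [Real.fourierInv_eq'] at inv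
  rw [← inv]
  have hpi' : (Real.pi : ℂ) ≠ 0 := by exact_mod_cast Real.pi_ne_zero
  -- The Fourier transform of Mathlib carries 2π in the exponent; the substitution ξ = s/(2π)
  -- changes normalization, and its Jacobian is the prefactor 1/(2π).
  have scale := Measure.integral_comp_mul_left
    (fun ξ : ℝ => cexp (↑(2 * Real.pi * inner ℝ ξ x) * I) • FourierTransform.fourier h ξ)
    (2 * Real.pi)⁻¹
  rw [inv_inv, abs_of_pos Real.two_pi_pos] at scale
  have pointwise : ∀ s : ℝ,
      ((1 / (2 * Real.pi) : ℂ) * ∫ u : ℝ, h u * cexp (-I * (s * u))) * cexp (I * (s * x)) =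
      (1 / (2 * Real.pi) : ℂ) * (cexp (↑(2 * Real.pi * inner ℝ ((2 * Real.pi)⁻¹ * s) x) * I) •
        FourierTransform.fourier h ((2 * Real.pi)⁻¹ * s)) := fun s => by
    rw [Real.fourier_real_eq_integral_exp_smul, smul_eq_mul, mul_assoc, mul_comm (cexp _)]
    congr 2
    · refine integral_congr_ae (.of_forall fun u => ?_)
      simp only [smul_eq_mul]
      rw [mul_comm]
      congr 2
      push_cast
      field_simp
    · congr 1
      simp only [RCLike.inner_apply, conj_trivial]
      push_cast
      field_simp
  simp_rw [pointwise]
  have cancel : (1 / (2 * Real.pi) : ℂ) * ((2 * Real.pi : ℝ) : ℂ) = 1 := by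
    push_cast
    field_simp
  rw [integral_const_mul, scale, Complex.real_smul, ← mul_assoc, cancel, one_mul]

/-! ### The convolution algebra of test functions -/

/-- The smooth functions on the plane with compact support. -/
def TestFn : Submodule ℂ Fn where
  carrier := {φ | ContDiff ℝ (⊤ : ℕ∞) φ ∧ HasCompactSupport φ}
  zero_mem' := ⟨contDiff_const, HasCompactSupport.zero⟩
  add_mem' h h' := ⟨h.1.add h'.1, h.2.add h'.2⟩
  smul_mem' c _ h := ⟨contDiff_const.smul h.1, h.2.mul_left (f := fun _ => c)⟩

/-- The integrand of the convolution, as a function of the point and the variable of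
integration. -/
def convKernel (κ : ℝ) (φ ψ : Fn) (x : (ℝ × ℝ) × (ℝ × ℝ)) : ℂ :=
  φ (x.2.1, x.1.2 - Real.exp (x.2.1 / κ) * x.2.2) * ψ (x.1.1 - x.2.1, x.2.2)

theorem contDiff_convKernel (κ : ℝ) {φ ψ : ℝ × ℝ → ℂ} (hφ : φ ∈ TestFn) (hψ : ψ ∈ TestFn) :
    ContDiff ℝ (⊤ : ℕ∞) (convKernel κ φ ψ) := by
  have := hφ.1
  have := hψ.1
  unfold convKernel
  fun_prop

/-- The kernel is φ ⊗ ψ pulled back along a map of ℝ⁴ with a continuous left inverse, hence along a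
closed embedding. -/
theorem hasCompactSupport_convKernel (κ : ℝ) {φ ψ : Fn} (hφ : φ ∈ TestFn) (hψ : ψ ∈ TestFn) :
    HasCompactSupport (convKernel κ φ ψ) := by
  refine (hasCompactSupport_tensor hφ.2 hψ.2).comp_isClosedEmbedding
    (g := fun x : (ℝ × ℝ) × (ℝ × ℝ) =>
      ((x.2.1, x.1.2 - Real.exp (x.2.1 / κ) * x.2.2), (x.1.1 - x.2.1, x.2.2)))
    (Function.LeftInverse.isClosedEmbedding (f := fun y : (ℝ × ℝ) × (ℝ × ℝ) =>
      ((y.1.1 + y.2.1, y.1.2 + Real.exp (y.1.1 / κ) * y.2.2), (y.1.1, y.2.2))) (fun x => ?_)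
      (by fun_prop) (by fun_prop))
  simp

/-- The convolution of functions on the group of affine maps of the line,
`(φ ψ)(w, c) = (1 / 2π) ∫ φ(u, c - exp (u / κ) b) ψ(w - u, b) du db`. -/
def conv (κ : ℝ) (φ ψ : Fn) : Fn := fun p =>
  (1 / (2 * Real.pi) : ℂ) * ∫ q : ℝ × ℝ, convKernel κ φ ψ (p, q)

theorem conv_mem (κ : ℝ) {φ ψ : Fn} (hφ : φ ∈ TestFn) (hψ : ψ ∈ TestFn) : conv κ φ ψ ∈ TestFn :=
  ⟨contDiff_const.mul
      (contDiff_marginal (contDiff_convKernel κ hφ hψ) (hasCompactSupport_convKernel κ hφ hψ)),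
    (hasCompactSupport_marginal (hasCompactSupport_convKernel κ hφ hψ)).mul_left
      (f := fun _ => (1 / (2 * Real.pi) : ℂ))⟩

theorem integrable_convKernel (κ : ℝ) {φ ψ : Fn} (hφ : φ ∈ TestFn) (hψ : ψ ∈ TestFn)
    (p : ℝ × ℝ) : Integrable fun q => convKernel κ φ ψ (p, q) := by
  refine Continuous.integrable_of_hasCompactSupport
    ((contDiff_convKernel κ hφ hψ).continuous.comp (by fun_prop)) ?_
  exact (hasCompactSupport_convKernel κ hφ hψ).comp_isClosedEmbedding
    (Function.LeftInverse.isClosedEmbedding (f := Prod.snd) (fun _ => rfl) (by fun_prop)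
      (by fun_prop))

theorem add_conv (κ : ℝ) {φ φ' ψ : Fn} (hφ : φ ∈ TestFn) (hφ' : φ' ∈ TestFn) (hψ : ψ ∈ TestFn) :
    conv κ (φ + φ') ψ = conv κ φ ψ + conv κ φ' ψ := by
  ext p
  simp only [conv, Pi.add_apply]
  rw [← mul_add, ← integral_add (integrable_convKernel κ hφ hψ p)
    (integrable_convKernel κ hφ' hψ p)]
  simp only [convKernel, Pi.add_apply, add_mul]

theorem conv_add (κ : ℝ) {φ ψ ψ' : Fn} (hφ : φ ∈ TestFn) (hψ : ψ ∈ TestFn) (hψ' : ψ' ∈ TestFn) :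
    conv κ φ (ψ + ψ') = conv κ φ ψ + conv κ φ ψ' := by
  ext p
  simp only [conv, Pi.add_apply]
  rw [← mul_add, ← integral_add (integrable_convKernel κ hφ hψ p)
    (integrable_convKernel κ hφ hψ' p)]
  simp only [convKernel, Pi.add_apply, mul_add]

theorem smul_conv (κ : ℝ) (r : ℂ) (φ ψ : Fn) : conv κ (r • φ) ψ = r • conv κ φ ψ := by
  ext p
  simp only [conv, convKernel, Pi.smul_apply, smul_eq_mul, mul_assoc, integral_const_mul]
  ring

theorem conv_smul (κ : ℝ) (r : ℂ) (φ ψ : Fn) : conv κ φ (r • ψ) = r • conv κ φ ψ := by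
  ext p
  simp only [conv, convKernel, Pi.smul_apply, smul_eq_mul, mul_left_comm _ r, integral_const_mul]

/-- Invariance of the integral over the plane under shears. -/
theorem integral_shear {h : ℝ → ℝ} (hh : Continuous h) (F : ℝ × ℝ → ℂ) :
    ∫ q : ℝ × ℝ, F (q.1, q.2 + h q.1) = ∫ q, F q := by
  let e : (ℝ × ℝ) ≃ₜ (ℝ × ℝ) :=
    { toFun := fun q => (q.1, q.2 + h q.1)
      invFun := fun q => (q.1, q.2 - h q.1)
      left_inv := fun q => by simp
      right_inv := fun q => by simp
      continuous_toFun := by fun_prop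
      continuous_invFun := by fun_prop }
  have he : MeasurePreserving e := by
    refine (MeasurePreserving.id volume).skew_product (g := fun a b => b + h a)
      (Continuous.measurable (by fun_prop)) (.of_forall fun a => ?_)
    exact (measurePreserving_add_right volume (h a)).map_eq
  exact he.integral_comp e.measurableEmbedding F

/-- Both sides are double integrals of one function G of compact support: the left side after a
shear of the inner variable, the right side after a translation. Fubini then exchanges the order. -/
theorem conv_assoc (κ : ℝ) {φ ψ χ : ℝ × ℝ → ℂ} (hφ : φ ∈ TestFn) (hψ : ψ ∈ TestFn) (hχ : χ ∈ TestFn) :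
    conv κ (conv κ φ ψ) χ = conv κ φ (conv κ ψ χ) := by
  ext p
  let G : ℝ × ℝ → ℝ × ℝ → ℂ := fun q r =>
    φ (r.1, p.2 - Real.exp (r.1 / κ) * r.2) *
      (ψ (q.1 - r.1, r.2 - Real.exp ((q.1 - r.1) / κ) * q.2) * χ (p.1 - q.1, q.2))
  have hG : Continuous (Function.uncurry G) := by
    have := hφ.1.continuous
    have := hψ.1.continuous
    have := hχ.1.continuous
    simp only [G, Function.uncurry_def]
    fun_prop
  have hGc : HasCompactSupport (Function.uncurry G) := by
    refine (hasCompactSupport_tensor hφ.2 (hasCompactSupport_tensor hψ.2 hχ.2)).comp_isClosedEmbedding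
      (g := fun x : (ℝ × ℝ) × (ℝ × ℝ) => ((x.2.1, p.2 - Real.exp (x.2.1 / κ) * x.2.2),
        ((x.1.1 - x.2.1, x.2.2 - Real.exp ((x.1.1 - x.2.1) / κ) * x.1.2),
          (p.1 - x.1.1, x.1.2))))
      (Function.LeftInverse.isClosedEmbedding
        (f := fun y : (ℝ × ℝ) × ((ℝ × ℝ) × (ℝ × ℝ)) =>
          ((p.1 - y.2.2.1, y.2.2.2),
            (y.1.1, y.2.1.2 + Real.exp (y.2.1.1 / κ) * y.2.2.2))) (fun x => ?_)
        (by fun_prop) (by fun_prop))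
    simp
  have left : ∀ q : ℝ × ℝ, convKernel κ (conv κ φ ψ) χ (p, q) =
      (1 / (2 * Real.pi) : ℂ) * ∫ r, G q r := fun q => by
    rw [← integral_shear (h := fun u => Real.exp ((q.1 - u) / κ) * q.2) (by fun_prop)]
    simp only [convKernel, conv, mul_assoc]
    rw [← integral_mul_const]
    congr 2 with r
    simp only [G, mul_assoc]
    congr 3
    · rw [mul_add, ← mul_assoc, ← Real.exp_add, ← add_div]
      simp only [add_sub_cancel]
      ring
    · simp
  have right : ∀ r : ℝ × ℝ, convKernel κ φ (conv κ ψ χ) (p, r) =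
      (1 / (2 * Real.pi) : ℂ) * ∫ q, G q r := fun r => by
    rw [← integral_add_right_eq_self _ ((r.1, 0) : ℝ × ℝ)]
    simp only [convKernel, conv]
    rw [mul_left_comm, ← integral_const_mul]
    congr 2 with q
    simp [G, sub_sub, add_comm]
  unfold conv at left right ⊢
  simp_rw [left, right]
  rw [integral_const_mul, integral_const_mul, integral_integral_swap_of_hasCompactSupport hG hGc]

/-! ### The Fourier transform of test functions -/

/-- Multiplication by `exp (γ u)`. -/
def expMul (γ : ℝ) (φ : Fn) : Fn := fun q => (Real.exp (γ * q.1) : ℂ) * φ q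

/-- Multiplication by `-i v`. -/
def coordMul (φ : Fn) : Fn := fun q => -I * (q.2 : ℂ) * φ q

theorem expMul_mem (γ : ℝ) {φ : ℝ × ℝ → ℂ} (hφ : φ ∈ TestFn) : expMul γ φ ∈ TestFn := by
  have h := hφ.1
  refine ⟨?_, hφ.2.mul_left⟩
  refine ContDiff.mul ?_ h
  exact ofRealCLM.contDiff.comp (by fun_prop : ContDiff ℝ (⊤ : ℕ∞)
    fun q : ℝ × ℝ => Real.exp (γ * q.1))

theorem coordMul_mem {φ : ℝ × ℝ → ℂ} (hφ : φ ∈ TestFn) : coordMul φ ∈ TestFn := by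
  refine ⟨?_, hφ.2.mul_left⟩
  refine ContDiff.mul (contDiff_const.mul ?_) hφ.1
  exact ofRealCLM.contDiff.comp contDiff_snd

/-- The Fourier transform in the second variable,
`(u, β) ↦ ∫ φ(u, w) exp (-i β w) dw`. -/
def partialFourier (φ : Fn) (β u : ℝ) : ℂ := ∫ w : ℝ, φ (u, w) * cexp (-I * (β * w))

theorem contDiff_mul_cexp {φ : ℝ × ℝ → ℂ} (hφ : φ ∈ TestFn) (a b : ℝ) :
    ContDiff ℝ (⊤ : ℕ∞) fun q : ℝ × ℝ => φ q * cexp (-I * (a * q.1 + b * q.2)) := by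
  refine hφ.1.mul (ContDiff.cexp (contDiff_const.mul ?_))
  exact (contDiff_const.mul (ofRealCLM.contDiff.comp contDiff_fst)).add
    (contDiff_const.mul (ofRealCLM.contDiff.comp contDiff_snd))

theorem contDiff_partialFourier {φ : Fn} (hφ : φ ∈ TestFn) (β : ℝ) :
    ContDiff ℝ (⊤ : ℕ∞) (partialFourier φ β) := by
  unfold partialFourier
  simpa using contDiff_marginal (contDiff_mul_cexp hφ 0 β) (hφ.2.mul_right)

theorem hasCompactSupport_partialFourier {φ : Fn} (hφ : φ ∈ TestFn) (β : ℝ) :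
    HasCompactSupport (partialFourier φ β) :=
  hasCompactSupport_marginal (H := fun q : ℝ × ℝ => φ q * cexp (-I * (β * q.2))) hφ.2.mul_right

theorem fourier_eq_integral_partialFourier {φ : Fn} (hφ : φ ∈ TestFn) (α β : ℝ) :
    fourier φ (α, β) =
      (1 / (2 * Real.pi) : ℂ) * ∫ u : ℝ, partialFourier φ β u * cexp (-I * (α * u)) := by
  unfold fourier
  rw [Measure.volume_eq_prod, integral_prod _ (integrable_fourier hφ.1 hφ.2 (α, β))]
  congr 2 with u
  rw [partialFourier, ← integral_mul_const]
  congr 1 with w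
  rw [mul_assoc, ← Complex.exp_add]
  ring_nf

/-- The inner integrals of `T` and of `starMul` have this form. Carrying them out first undoes the
Fourier transform in one variable and leaves a compactly supported function for the outer integral,
although the joint integrands are in general not absolutely integrable. -/
theorem integral_fourier_mul_cexp {φ : Fn} (hφ : φ ∈ TestFn) (β x : ℝ) :
    ∫ s : ℝ, fourier φ (s, β) * cexp (I * (s * x)) = partialFourier φ β x := by
  simp_rw [fourier_eq_integral_partialFourier hφ]
  exact fourier_inversion_line (contDiff_partialFourier hφ β)
    (hasCompactSupport_partialFourier hφ β) x

theorem T_fourier (γ : ℝ) {φ : Fn} (hφ : φ ∈ TestFn) :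
    T γ (fourier φ) = fourier (expMul γ φ) := by
  ext ⟨α, β⟩
  -- The inner integral of `T` produces the partial transform at -p, hence the reflection of the
  -- outer variable.
  rw [fourier_eq_integral_partialFourier (expMul_mem γ hφ), T, ← integral_neg_eq_self]
  congr 2 with p
  have h1 : partialFourier (expMul γ φ) β p = Real.exp (γ * p) * partialFourier φ β p := by
    rw [partialFourier, partialFourier, ← integral_const_mul]
    simp only [expMul, mul_assoc]
  rw [h1, ← integral_fourier_mul_cexp hφ, ← integral_const_mul, ← integral_mul_const]
  congr 1 with s
  have h2 : cexp (-I * (((-p : ℝ) : ℂ) * (s - α))) = cexp (I * (s * p)) * cexp (-I * (α * p)) := by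
    rw [← Complex.exp_add]
    push_cast
    ring_nf
  rw [h2]
  simp only [neg_mul_neg]
  ring

theorem starMul_fourier (κ : ℝ) {φ ψ : Fn} (hφ : φ ∈ TestFn) (hψ : ψ ∈ TestFn) :
    starMul κ (fourier φ) (fourier ψ) = fourier (conv κ φ ψ) := by
  ext ⟨α, β⟩
  have hstar : starMul κ (fourier φ) (fourier ψ) (α, β) = (1 / (2 * Real.pi) : ℂ) *
      ∫ u : ℝ, partialFourier φ β u * cexp (-I * (α * u)) *
        fourier ψ (α, Real.exp (u / κ) * β) := by
    rw [starMul, ← integral_neg_eq_self]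
    congr 2 with v
    rw [← integral_fourier_mul_cexp hφ, ← integral_mul_const, ← integral_mul_const]
    refine Eq.trans ?_ (integral_add_left_eq_self (fun s : ℝ => fourier φ (s, β) *
      cexp (I * (s * v)) * cexp (-I * (α * v)) * fourier ψ (α, Real.exp (v / κ) * β)) α)
    congr 1 with u
    have h : cexp (I * (((α + u : ℝ) : ℂ) * v)) * cexp (-I * (α * v)) =
        cexp (-I * (u * ((-v : ℝ) : ℂ))) := by
      rw [← Complex.exp_add]
      push_cast
      ring_nf
    rw [neg_neg, ← h]
    ring
  let K : (ℝ × ℝ) → (ℝ × ℝ) → ℂ := fun p q =>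
    convKernel κ φ ψ (p, q) * cexp (-I * (α * p.1 + β * p.2))
  have hK : Continuous (Function.uncurry K) := by
    refine (contDiff_convKernel κ hφ hψ).continuous.mul ?_
    fun_prop
  have hKc : HasCompactSupport (Function.uncurry K) :=
    (hasCompactSupport_convKernel κ hφ hψ).mul_right
  let c : ℂ := 1 / (2 * Real.pi)
  -- Right translation by q in the affine group: the kernel separates into a factor in φ and a
  -- factor in ψ, and the second character is evaluated at exp(q.1/κ) β, the dilated argument in the
  -- star product.
  have hshift : ∀ q : ℝ × ℝ, ∫ p, K p q = partialFourier φ β q.1 * cexp (-I * (α * q.1)) *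
      ∫ w : ℝ, ψ (w, q.2) * cexp (-I * (α * w + (Real.exp (q.1 / κ) * β : ℝ) * q.2)) := fun q => by
    rw [← integral_add_right_eq_self _ ((q.1, Real.exp (q.1 / κ) * q.2) : ℝ × ℝ),
      mul_comm (partialFourier φ β q.1 * _),
      partialFourier, ← integral_mul_const (cexp (-I * (α * q.1))), ← integral_prod_mul, ← Measure.volume_eq_prod]
    congr 1 with p
    simp only [K, convKernel, Prod.fst_add, Prod.snd_add, add_sub_cancel_right]
    have h : cexp (-I * (α * ((p.1 + q.1 : ℝ) : ℂ) +
        β * ((p.2 + Real.exp (q.1 / κ) * q.2 : ℝ) : ℂ))) =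
        cexp (-I * (α * p.1 + (Real.exp (q.1 / κ) * β : ℝ) * q.2)) *
          (cexp (-I * (β * p.2)) * cexp (-I * (α * q.1))) := by
      rw [← Complex.exp_add, ← Complex.exp_add]
      push_cast
      ring_nf
    rw [h]
    ring
  have hconv : fourier (conv κ φ ψ) (α, β) = c * (c * ∫ q, ∫ p, K p q) := by
    rw [← integral_integral_swap_of_hasCompactSupport hK hKc, ← integral_const_mul]
    simp only [fourier, conv, c]
    congr 2 with p
    rw [mul_assoc, ← integral_mul_const]
  have hint : Integrable (fun q => ∫ p, K p q) := by
    have hs : HasCompactSupport fun x : (ℝ × ℝ) × (ℝ × ℝ) => K x.2 x.1 :=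
      hKc.comp_homeomorph (Homeomorph.prodComm _ _)
    exact ((hK.comp continuous_swap).integrable_of_hasCompactSupport
      (μ := volume.prod volume) hs).integral_prod_left
  have hfub : ∫ q, ∫ p, K p q = ∫ u : ℝ, ∫ b : ℝ, ∫ p, K p (u, b) := integral_prod _ hint
  rw [hstar, hconv]
  refine congrArg (c * ·) ?_
  rw [hfub, ← integral_const_mul c]
  congr 1 with u
  simp_rw [hshift]
  rw [integral_const_mul, mul_left_comm c]
  congr 1
  exact congrArg (c * ·) (integral_prod_symm _
    (integrable_fourier hψ.1 hψ.2 (α, Real.exp (u / κ) * β)))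

theorem P_fourier {φ : Fn} (hφ : φ ∈ TestFn) : P (fourier φ) = fourier (coordMul φ) := by
  ext ⟨α, β⟩
  have hd := hasDerivAt_integral_of_dominated_loc_of_deriv_le (𝕜 := ℝ) (μ := volume)
    (F := fun (b : ℝ) (q : ℝ × ℝ) => φ q * cexp (-I * (α * q.1 + b * q.2)))
    (F' := fun (b : ℝ) (q : ℝ × ℝ) => coordMul φ q * cexp (-I * (α * q.1 + b * q.2)))
    (x₀ := β) (s := Set.univ) (bound := fun q => ‖coordMul φ q‖) Filter.univ_mem
    (.of_forall fun b => (integrable_fourier hφ.1 hφ.2 (α, b)).aestronglyMeasurable)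
    (integrable_fourier hφ.1 hφ.2 (α, β))
    (integrable_fourier (coordMul_mem hφ).1 (coordMul_mem hφ).2 (α, β)).aestronglyMeasurable
    (.of_forall fun q b _ => by
      rw [norm_mul, Complex.norm_exp]
      simp)
    ((coordMul_mem hφ).1.continuous.integrable_of_hasCompactSupport (coordMul_mem hφ).2).norm
    (.of_forall fun q b _ => by
      have h1 : HasDerivAt (fun b : ℝ => -I * (α * q.1 + (b : ℂ) * q.2)) (-I * (1 * q.2)) b :=
        (((hasDerivAt_id b).ofReal_comp.mul_const (q.2 : ℂ)).const_add _).const_mul _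
      refine (h1.cexp.const_mul (φ q)).congr_deriv ?_
      simp only [coordMul]
      ring)
  exact (hd.2.const_mul (1 / (2 * Real.pi) : ℂ)).deriv

/-- The Fourier transform of a Schwartz function is Schwartz, hence integrable. The product ℝ × ℝ
carries the sup norm, so the argument runs on `WithLp 2 (ℝ × ℝ)` and rescales by (2π)⁻¹. -/
theorem integrable_fourier_transform {φ : Fn} (hφ : φ ∈ TestFn) : Integrable (fourier φ) := by
  let e := WithLp.prodContinuousLinearEquiv 2 ℝ ℝ ℝ
  let S : SchwartzMap (WithLp 2 (ℝ × ℝ)) ℂ :=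
    HasCompactSupport.toSchwartzMap (f := fun x => φ (e x))
      (hφ.2.comp_homeomorph e.toHomeomorph) (hφ.1.comp e.contDiff)
  have hS : Integrable (FourierTransform.fourier (S : WithLp 2 (ℝ × ℝ) → ℂ)) := by
    rw [← SchwartzMap.fourier_coe]
    exact SchwartzMap.integrable _
  have h1 : Integrable fun p : ℝ × ℝ => FourierTransform.fourier (S : WithLp 2 (ℝ × ℝ) → ℂ)
      (WithLp.toLp 2 p) :=
    (WithLp.volume_preserving_toLp ℝ ℝ).integrable_comp_of_integrable hS
  have h2 := (h1.comp_smul (R := (2 * Real.pi)⁻¹) (by positivity)).const_mul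
    (1 / (2 * Real.pi) : ℂ)
  refine h2.congr (.of_forall fun p => ?_)
  simp only [fourier]
  rw [Real.fourier_eq', ← (WithLp.volume_preserving_toLp ℝ ℝ).integral_comp
    (MeasurableEquiv.toLp 2 (ℝ × ℝ)).measurableEmbedding]
  congr 2 with q
  have hpi : (Real.pi : ℂ) ≠ 0 := by exact_mod_cast Real.pi_ne_zero
  rw [smul_eq_mul, mul_comm]
  congr 2
  simp [WithLp.prod_inner_apply]
  field_simp

theorem integral_fourier {φ : Fn} (hφ : φ ∈ TestFn) :
    ∫ x, fourier φ x = 2 * Real.pi * φ 0 := by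
  have hpi : (Real.pi : ℂ) ≠ 0 := by exact_mod_cast Real.pi_ne_zero
  have hint := integrable_fourier_transform hφ
  rw [Measure.volume_eq_prod] at hint ⊢
  -- Integrating over α first restricts φ to the line u = 0; inversion on that line at 0 then gives
  -- φ(0).
  rw [integral_prod_symm _ hint]
  have h1 : ∀ β, ∫ α, fourier φ (α, β) = partialFourier φ β 0 := fun β => by
    simpa using integral_fourier_mul_cexp hφ β 0
  simp_rw [h1, partialFourier]
  have hline : ContDiff ℝ (⊤ : ℕ∞) fun w : ℝ => φ (0, w) :=
    hφ.1.comp (contDiff_const.prodMk contDiff_id)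
  have hlinec : HasCompactSupport fun w : ℝ => φ (0, w) :=
    hφ.2.comp_isClosedEmbedding (g := fun w : ℝ => ((0, w) : ℝ × ℝ))
      (Function.LeftInverse.isClosedEmbedding (f := Prod.snd) (fun _ => rfl) (by fun_prop)
        (by fun_prop))
  have h2 := fourier_inversion_line hline hlinec 0
  simp only [ofReal_zero, mul_zero, Complex.exp_zero, mul_one, integral_const_mul] at h2
  rw [Prod.zero_eq_mk, ← h2]
  field_simp

/-! ### Words in anticommuting operators -/

/-- The sign in `e i ∧ e (K \ {i}) = ± e K`, and `0` if `i ∉ K`. -/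
def genSign (i : Fin 3) (K : Finset (Fin 3)) : ℤ :=
  if i ∈ K then (-1) ^ (K.filter (· < i)).card else 0

theorem genSign_anticomm (i j : Fin 3) (K : Finset (Fin 3)) :
    genSign i K * genSign j (K.erase i) = -(genSign j K * genSign i (K.erase j)) := by
  revert i j K
  decide

theorem sort_insert_eq_orderedInsert (j : Fin 3) {J : Finset (Fin 3)} (hj : j ∉ J) :
    (insert j J).sort (· ≤ ·) = (J.sort (· ≤ ·)).orderedInsert (· ≤ ·) j := by
  have hset : insert j J = ((J.sort (· ≤ ·)).orderedInsert (· ≤ ·) j).toFinset := by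
    ext k
    simp [List.mem_orderedInsert]
  rw [hset, List.toFinset_sort]
  · exact (Finset.pairwise_sort J (· ≤ ·)).orderedInsert j _
  · exact (List.perm_orderedInsert _ _ _).nodup_iff.2 (by simp [hj])

section Words

variable {X : Type*} [AddCommGroup X] [Module ℂ X] {s : Fin 3 → X →ₗ[ℂ] X}

theorem eq_zero_of_eq_neg {x : X} (h : x = -x) : x = 0 := by
  have h2 : (2 : ℂ) • x = 0 := by
    rw [two_smul]
    nth_rewrite 2 [h]
    exact add_neg_cancel x
  exact (smul_eq_zero.1 h2).resolve_left two_ne_zero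

theorem foldr_mem_eq_zero (hs : ∀ i j x, s i (s j x) = -s j (s i x)) (x : X) {j : Fin 3}
    {l : List (Fin 3)} (hj : j ∈ l) : s j (l.foldr (fun i y => s i y) x) = 0 := by
  induction l with
  | nil => simp at hj
  | cons k l ih =>
    rw [List.foldr_cons]
    rcases List.mem_cons.1 hj with rfl | h
    · exact eq_zero_of_eq_neg (hs j j _)
    · rw [hs, ih h, map_zero, neg_zero]

theorem foldr_orderedInsert (hs : ∀ i j x, s i (s j x) = -s j (s i x)) (x : X) {j : Fin 3}
    {l : List (Fin 3)} (hl : l.Pairwise (· ≤ ·)) (hj : j ∉ l) :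
    s j (l.foldr (fun i y => s i y) x) =
      ((-1) ^ l.countP (· < j) : ℤ) • (l.orderedInsert (· ≤ ·) j).foldr (fun i y => s i y) x := by
  induction l with
  | nil => simp
  | cons k l ih =>
    rw [List.pairwise_cons] at hl
    rw [List.mem_cons, not_or] at hj
    by_cases h : j ≤ k
    · have h0 : (k :: l).countP (· < j) = 0 := by
        rw [List.countP_eq_zero]
        intro a ha
        rcases List.mem_cons.1 ha with rfl | ha
        · simpa using h
        · simpa using h.trans (hl.1 a ha)
      simp [h0, h]
    · rw [List.foldr_cons, hs, ih hl.2 hj.2]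
      simp [h, lt_of_not_ge h, pow_succ]

/-- Stated for any anticommuting family because it serves twice: for multiplication by generators,
and for the operators that move a function through a generator. The second use makes the left
action, defined on sorted words, obey the bimodule rules on every word. -/
theorem foldr_sort (hs : ∀ i j x, s i (s j x) = -s j (s i x)) (x : X) (j : Fin 3)
    (J : Finset (Fin 3)) :
    s j ((J.sort (· ≤ ·)).foldr (fun i y => s i y) x) =
      if j ∈ J then 0 else genSign j (insert j J) •
        ((insert j J).sort (· ≤ ·)).foldr (fun i y => s i y) x := by
  split_ifs with hj
  · exact foldr_mem_eq_zero hs x (by simpa using hj)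
  · rw [foldr_orderedInsert hs x (Finset.pairwise_sort J (· ≤ ·)) (by simpa using hj),
      sort_insert_eq_orderedInsert j hj]
    congr 1
    rw [genSign, if_pos (Finset.mem_insert_self _ _), Finset.filter_insert, if_neg (lt_irrefl j)]
    congr 1
    rw [← Multiset.coe_countP, Finset.sort_eq, Multiset.countP_eq_card_filter]
    simp [Finset.card_def]

end Words

/-! ### Forms with coefficients in a module -/

section Degree

variable {A : Type*} [AddCommGroup A]

/-- The forms of degree `k`. -/
def HasDegree (k : ℕ) (ω : Finset (Fin 3) → A) : Prop := ∀ I, I.card ≠ k → ω I = 0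

theorem HasDegree.add {k : ℕ} {ω η : Finset (Fin 3) → A} (hω : HasDegree k ω)
    (hη : HasDegree k η) : HasDegree k (ω + η) := fun I hI => by simp [hω I hI, hη I hI]

theorem HasDegree.zero (k : ℕ) : HasDegree k (0 : Finset (Fin 3) → A) := fun _ _ => rfl

theorem HasDegree.sum {ι : Type*} {k : ℕ} {t : Finset ι} {f : ι → Finset (Fin 3) → A}
    (h : ∀ i, HasDegree k (f i)) : HasDegree k (∑ i ∈ t, f i) :=
  Finset.sum_induction _ _ (fun _ _ => HasDegree.add) (HasDegree.zero k) fun i _ => h i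

end Degree

section Forms

variable {A : Type*} [AddCommGroup A] [Module ℂ A]

/-- Left multiplication by a generating one-form. -/
def genMul (i : Fin 3) : (Finset (Fin 3) → A) →ₗ[ℂ] (Finset (Fin 3) → A) where
  toFun ω K := genSign i K • ω (K.erase i)
  map_add' ω η := by
    ext K
    simp
  map_smul' c ω := by
    ext K
    exact smul_comm _ c _

theorem genMul_apply (i : Fin 3) (ω : Finset (Fin 3) → A) (K : Finset (Fin 3)) :
    genMul i ω K = genSign i K • ω (K.erase i) := rfl

theorem genMul_anticomm (i j : Fin 3) (ω : Finset (Fin 3) → A) :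
    genMul i (genMul j ω) = -genMul j (genMul i ω) := by
  ext K
  simp only [genMul_apply, Pi.neg_apply, smul_smul]
  rw [genSign_anticomm, Finset.erase_right_comm, neg_smul]

/-- An element as a form of degree `0`. -/
def inc : A →ₗ[ℂ] (Finset (Fin 3) → A) := LinearMap.single ℂ (fun _ => A) ∅

theorem genMul_single (i : Fin 3) (J : Finset (Fin 3)) (a : A) :
    genMul i (Pi.single J a) =
      if i ∈ J then 0 else genSign i (insert i J) • Pi.single (insert i J) a := by
  ext K
  rw [genMul_apply]
  by_cases hK : i ∈ K
  · by_cases hJ : i ∈ J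
    · have : K.erase i ≠ J := fun h => by simp [← h] at hJ
      simp [hJ, this]
    · by_cases h : K = insert i J
      · subst h
        simp [hJ]
      · have : K.erase i ≠ J := fun h' => h (by rw [← h', Finset.insert_erase hK])
        simp [hJ, h, this]
  · have h0 : genSign i K = 0 := if_neg hK
    have : K ≠ insert i J := fun h => hK (by simp [h])
    split_ifs <;> simp [h0, this]

/-- The word `e i₁ ∧ ⋯ ∧ e iₚ ∧ ω`. -/
def wordMul (l : List (Fin 3)) : (Finset (Fin 3) → A) →ₗ[ℂ] (Finset (Fin 3) → A) :=
  l.foldr (fun i F => genMul i ∘ₗ F) LinearMap.id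

@[simp] theorem wordMul_nil (ω : Finset (Fin 3) → A) : wordMul [] ω = ω := rfl

@[simp] theorem wordMul_cons (i : Fin 3) (l : List (Fin 3)) (ω : Finset (Fin 3) → A) :
    wordMul (i :: l) ω = genMul i (wordMul l ω) := rfl

theorem wordMul_eq_foldr (l : List (Fin 3)) (ω : Finset (Fin 3) → A) :
    wordMul l ω = l.foldr (fun i η => genMul i η) ω := by
  induction l with
  | nil => rfl
  | cons i l ih => rw [wordMul_cons, ih, List.foldr_cons]

theorem genMul_wordMul_sort (j : Fin 3) (J : Finset (Fin 3)) (ω : Finset (Fin 3) → A) :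
    genMul j (wordMul (J.sort (· ≤ ·)) ω) =
      if j ∈ J then 0 else genSign j (insert j J) • wordMul ((insert j J).sort (· ≤ ·)) ω := by
  simp only [wordMul_eq_foldr]
  exact foldr_sort genMul_anticomm ω j J

theorem wordMul_inc {l : List (Fin 3)} (hl : l.Pairwise (· < ·)) (a : A) :
    wordMul l (inc a) = Pi.single l.toFinset a := by
  induction l with
  | nil => rfl
  | cons i l ih =>
    rw [List.pairwise_cons] at hl
    have hi : i ∉ l.toFinset := fun h => lt_irrefl i (hl.1 i (List.mem_toFinset.1 h))
    have hs : genSign i (insert i l.toFinset) = 1 := by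
      rw [genSign, if_pos (Finset.mem_insert_self _ _)]
      convert pow_zero (-1 : ℤ)
      rw [Finset.card_eq_zero, Finset.filter_eq_empty_iff]
      intro k hk
      rcases Finset.mem_insert.1 hk with rfl | hk
      · exact lt_irrefl _
      · exact (hl.1 k (List.mem_toFinset.1 hk)).le.not_gt
    rw [wordMul_cons, ih hl.2, genMul_single, if_neg hi, hs, one_smul, List.toFinset_cons]

theorem wordMul_sort_inc (I : Finset (Fin 3)) (a : A) :
    wordMul (I.sort (· ≤ ·)) (inc a) = Pi.single I a := by
  rw [wordMul_inc (Finset.sortedLT_sort I).pairwise, Finset.sort_toFinset]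

theorem sum_wordMul (ω : Finset (Fin 3) → A) :
    ∑ I : Finset (Fin 3), wordMul (I.sort (· ≤ ·)) (inc (ω I)) = ω := by
  simp only [wordMul_sort_inc]
  exact Finset.univ_sum_single ω

/-- A property of forms that is closed under sums and under left multiplication by the generators
holds for all forms if it holds in degree `0`. -/
theorem forms_induction {p : (Finset (Fin 3) → A) → Prop} (hinc : ∀ a, p (inc a))
    (hadd : ∀ ω η, p ω → p η → p (ω + η)) (hgen : ∀ i ω, p ω → p (genMul i ω))
    (ω : Finset (Fin 3) → A) : p ω := by
  rw [← sum_wordMul ω]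
  refine Finset.sum_induction _ p hadd (by simpa using hinc 0) fun I _ => ?_
  induction I.sort (· ≤ ·) with
  | nil => exact hinc _
  | cons i l ih => exact hgen i _ ih

theorem HasDegree.genMul {k : ℕ} {ω : Finset (Fin 3) → A} (hω : HasDegree k ω) (i : Fin 3) :
    HasDegree (k + 1) (genMul i ω) := fun I hI => by
  rw [genMul_apply]
  by_cases hi : i ∈ I
  · rw [hω, smul_zero]
    have := Finset.card_erase_add_one hi
    omega
  · rw [genSign, if_neg hi, zero_smul]

theorem hasDegree_inc (a : A) : HasDegree 0 (inc a) := fun I hI =>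
  Pi.single_eq_of_ne (M := fun _ => A) (fun h => hI (by simp [h]) : I ≠ ∅) a

theorem HasDegree.wordMul {k : ℕ} {ω : Finset (Fin 3) → A} (hω : HasDegree k ω)
    (l : List (Fin 3)) : HasDegree (k + l.length) (wordMul l ω) := by
  induction l with
  | nil => exact hω
  | cons i l ih => exact ih.genMul i

/-- The forms of degree `k` are the sums of words of length `k`. -/
theorem HasDegree.induction {k : ℕ} {p : (Finset (Fin 3) → A) → Prop} (hzero : p 0)
    (hadd : ∀ ω η, p ω → p η → p (ω + η))
    (hword : ∀ l a, l.length = k → p (KappaMinkowski.wordMul l (inc a)))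
    {ω : Finset (Fin 3) → A} (hω : HasDegree k ω) : p ω := by
  rw [← sum_wordMul ω]
  refine Finset.sum_induction _ p hadd hzero fun I _ => ?_
  by_cases hI : I.card = k
  · exact hword _ _ (by simpa using hI)
  · simpa [hω I hI] using hzero

/-- The action of a linear map on the coefficients. -/
def mapCoeff (L : A →ₗ[ℂ] A) : (Finset (Fin 3) → A) →ₗ[ℂ] (Finset (Fin 3) → A) :=
  L.compLeft _

theorem mapCoeff_apply (L : A →ₗ[ℂ] A) (ω : Finset (Fin 3) → A) (I : Finset (Fin 3)) :
    mapCoeff L ω I = L (ω I) := rfl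

theorem mapCoeff_inc (L : A →ₗ[ℂ] A) (a : A) : mapCoeff L (inc a) = inc (L a) := by
  ext I
  by_cases h : I = ∅
  · subst h
    simp [mapCoeff_apply, inc]
  · simp [mapCoeff_apply, inc, h]

theorem mapCoeff_genMul (L : A →ₗ[ℂ] A) (i : Fin 3) (ω : Finset (Fin 3) → A) :
    mapCoeff L (genMul i ω) = genMul i (mapCoeff L ω) := by
  ext I
  simp [mapCoeff_apply, genMul_apply]

end Forms

/-! ### The differential calculus over an abstract algebra -/

/-- An associative algebra with an automorphism `E`, a twisted derivation `P` commuting with `E`,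
and a twisted trace invariant under both. -/
structure KappaCalculus (A : Type*) [AddCommGroup A] [Module ℂ A] where
  /-- The product. -/
  mul : A →ₗ[ℂ] A →ₗ[ℂ] A
  /-- The automorphism. -/
  E : A →ₗ[ℂ] A
  /-- The inverse of the automorphism. -/
  Einv : A →ₗ[ℂ] A
  /-- The twisted derivation. -/
  P : A →ₗ[ℂ] A
  /-- The twisted trace. -/
  tr : A →ₗ[ℂ] ℂ
  mul_assoc : ∀ a b c, mul (mul a b) c = mul a (mul b c)
  E_Einv : ∀ a, E (Einv a) = a
  Einv_E : ∀ a, Einv (E a) = a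
  P_E : ∀ a, P (E a) = E (P a)
  E_mul : ∀ a b, E (mul a b) = mul (E a) (E b)
  P_mul : ∀ a b, P (mul a b) = mul (P a) b + mul (E a) (P b)
  tr_E : ∀ a, tr (E a) = tr a
  tr_P : ∀ a, tr (P a) = 0
  tr_mul : ∀ a b, tr (mul a b) = tr (mul (E b) a)

namespace KappaCalculus

variable {A : Type*} [AddCommGroup A] [Module ℂ A] (D : KappaCalculus A) (κ : ℝ)

theorem P_Einv (a : A) : D.P (D.Einv a) = D.Einv (D.P a) := by
  rw [← D.Einv_E (D.P (D.Einv a)), ← D.P_E, D.E_Einv]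

theorem Einv_mul (a b : A) : D.Einv (D.mul a b) = D.mul (D.Einv a) (D.Einv b) := by
  rw [← D.Einv_E (D.mul (D.Einv a) (D.Einv b)), D.E_mul, D.E_Einv, D.E_Einv]

theorem tr_Einv (a : A) : D.tr (D.Einv a) = D.tr a := by
  rw [← D.tr_E, D.E_Einv]

/-- The matrix of the bimodule rules. -/
def M : Fin 3 → Fin 3 → A →ₗ[ℂ] A :=
  ![![LinearMap.id, (2 * Complex.I / κ) • (D.Einv ∘ₗ D.P), 0],
    ![0, D.Einv, 0],
    ![(Complex.I / κ) • D.P, (-(1 / (κ : ℂ) ^ 2)) • (D.Einv ∘ₗ D.P ∘ₗ D.P), D.E]]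

/-- The components of the exterior derivative. -/
def partialD : Fin 3 → A →ₗ[ℂ] A :=
  ![D.Einv ∘ₗ D.P,
    (-(Complex.I * (κ / 2))) • (D.Einv - LinearMap.id),
    (1 / 2 : ℂ) • ((Complex.I / κ) • (D.Einv ∘ₗ D.P ∘ₗ D.P) +
      (Complex.I * κ) • (D.E - LinearMap.id))]

/-- All entries are polynomials in the commuting operators `E`, `Einv` and `P`. -/
theorem M_comm (i j k l : Fin 3) (a : A) :
    D.M κ i j (D.M κ k l a) = D.M κ k l (D.M κ i j a) := by
  fin_cases i <;> fin_cases j <;> fin_cases k <;> fin_cases l <;>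
    simp [M, P_Einv, D.P_E, D.E_Einv, D.Einv_E] <;> module

theorem E_M (i j : Fin 3) (a : A) : D.E (D.M κ i j a) = D.M κ i j (D.E a) := by
  fin_cases i <;> fin_cases j <;> simp [M, D.P_E, D.E_Einv, D.Einv_E]

theorem E_partialD (i : Fin 3) (a : A) : D.E (D.partialD κ i a) = D.partialD κ i (D.E a) := by
  fin_cases i <;> simp [partialD, D.P_E, D.E_Einv, D.Einv_E]

theorem partialD_M (i j k : Fin 3) (a : A) :
    D.partialD κ i (D.M κ j k a) = D.M κ j k (D.partialD κ i a) := by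
  fin_cases i <;> fin_cases j <;> fin_cases k <;>
    simp [M, partialD, P_Einv, D.P_E, D.E_Einv, D.Einv_E, smul_sub, smul_add] <;> module

theorem partialD_comm (i j : Fin 3) (a : A) :
    D.partialD κ i (D.partialD κ j a) = D.partialD κ j (D.partialD κ i a) := by
  fin_cases i <;> fin_cases j <;>
    simp [partialD, P_Einv, D.P_E, D.E_Einv, D.Einv_E, smul_sub, smul_add] <;> module

/-- Each entry's coproduct is the matrix coproduct. The delicate entry is the one with P²: its cross
term 2 `P a` · `Einv (P b)`, times -1/κ², must be the product of the off-diagonal entries i/κ and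
2i/κ, which is `h`. -/
theorem M_mul (i j : Fin 3) (a b : A) :
    D.M κ i j (D.mul a b) = ∑ k, D.mul (D.M κ i k a) (D.M κ k j b) := by
  have h : 2 * Complex.I / κ * (Complex.I / κ) = -(2 * ((κ : ℂ) ^ 2)⁻¹) := by
    rw [div_mul_div_comm, _root_.mul_assoc, Complex.I_mul_I, ← pow_two]
    ring
  fin_cases i <;> fin_cases j <;>
    simp [h, M, Fin.sum_univ_three, D.P_E, D.Einv_E, D.P_mul, D.E_mul,
      Einv_mul, smul_add, smul_smul] <;> module

/-- The normalizations of the derivatives are matched to `M`: for instance, in the dx component the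
product (2i/κ)(-iκ/2) = 1 turns the term in `Einv b - b` into the correction from `b` to `Einv b`.
-/
theorem partialD_mul (hκ : κ ≠ 0) (i : Fin 3) (a b : A) :
    D.partialD κ i (D.mul a b) =
      D.mul (D.partialD κ i a) b + ∑ k, D.mul (D.M κ i k a) (D.partialD κ k b) := by
  have hκ' : (κ : ℂ) ≠ 0 := by exact_mod_cast hκ
  have h1 : 2 * Complex.I / κ * (Complex.I * (κ / 2)) = -1 := by
    field_simp
    exact Complex.I_sq
  have h2 : ((κ : ℂ) ^ 2)⁻¹ * (Complex.I * (κ / 2)) = 2⁻¹ * (Complex.I / κ) := by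
    field_simp
  fin_cases i <;>
    simp [h1, h2, M, partialD, Fin.sum_univ_three, D.P_E, D.Einv_E, D.P_mul, D.E_mul,
      Einv_mul, smul_add, smul_sub, smul_smul] <;> module

theorem tr_partialD (i : Fin 3) (a : A) : D.tr (D.partialD κ i a) = 0 := by
  fin_cases i <;> simp [partialD, D.tr_Einv, D.tr_E, D.tr_P]

/-! ### The left action on forms -/

/-- The operator that moves the left factor of `f · ω` through the generator `e j`. -/
def moveThrough (j : Fin 3) :
    (A →ₗ[ℂ] A →ₗ[ℂ] (Finset (Fin 3) → A)) →ₗ[ℂ] (A →ₗ[ℂ] A →ₗ[ℂ] (Finset (Fin 3) → A)) where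
  toFun F := ∑ i, (F ∘ₗ D.M κ i j).compr₂ (genMul i)
  map_add' F G := by
    rw [← Finset.sum_add_distrib]
    refine Finset.sum_congr rfl fun i _ => ?_
    ext a b K
    simp
  map_smul' c F := by
    rw [RingHom.id_apply, Finset.smul_sum]
    refine Finset.sum_congr rfl fun i _ => ?_
    ext a b K
    simp

theorem moveThrough_apply (j : Fin 3) (F : A →ₗ[ℂ] A →ₗ[ℂ] (Finset (Fin 3) → A)) (a b : A) :
    D.moveThrough κ j F a b = ∑ i, genMul i (F (D.M κ i j a) b) := by
  simp [moveThrough, LinearMap.sum_apply]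

/-- Exchanging the two summation indices exchanges the two entries of the matrix, which commute, and
the two generators, which anticommute. -/
theorem moveThrough_anticomm (j k : Fin 3) (F : A →ₗ[ℂ] A →ₗ[ℂ] (Finset (Fin 3) → A)) :
    D.moveThrough κ j (D.moveThrough κ k F) = -D.moveThrough κ k (D.moveThrough κ j F) := by
  ext1 a
  ext1 b
  simp only [LinearMap.neg_apply, moveThrough_apply, map_sum]
  rw [Finset.sum_comm, ← Finset.sum_neg_distrib]
  refine Finset.sum_congr rfl fun i _ => ?_
  rw [← Finset.sum_neg_distrib]
  refine Finset.sum_congr rfl fun i' _ => ?_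
  rw [genMul_anticomm, M_comm]

/-- The product `f · (e j₁ ∧ ⋯ ∧ e jₚ) g`. -/
def leftMulWord (l : List (Fin 3)) : A →ₗ[ℂ] A →ₗ[ℂ] (Finset (Fin 3) → A) :=
  l.foldr (fun j F => D.moveThrough κ j F) (D.mul.compr₂ inc)

theorem leftMulWord_nil (a b : A) : D.leftMulWord κ [] a b = inc (D.mul a b) := rfl

theorem leftMulWord_cons (j : Fin 3) (l : List (Fin 3)) (a b : A) :
    D.leftMulWord κ (j :: l) a b = ∑ i, genMul i (D.leftMulWord κ l (D.M κ i j a) b) :=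
  D.moveThrough_apply κ j _ a b

/-- The left action of the algebra on forms. -/
def leftMul : A →ₗ[ℂ] (Finset (Fin 3) → A) →ₗ[ℂ] (Finset (Fin 3) → A) :=
  ∑ J : Finset (Fin 3), (D.leftMulWord κ (J.sort (· ≤ ·))).compl₂ (LinearMap.proj J)

theorem leftMul_apply (a : A) (ω : Finset (Fin 3) → A) :
    D.leftMul κ a ω = ∑ J : Finset (Fin 3), D.leftMulWord κ (J.sort (· ≤ ·)) a (ω J) := by
  simp [leftMul, LinearMap.sum_apply]

theorem leftMul_single (a : A) (J : Finset (Fin 3)) (b : A) :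
    D.leftMul κ a (Pi.single J b) = D.leftMulWord κ (J.sort (· ≤ ·)) a b := by
  rw [leftMul_apply, Finset.sum_eq_single J]
  · simp
  · intro I _ hI
    simp [hI]
  · simp

theorem leftMul_inc (a b : A) : D.leftMul κ a (inc b) = inc (D.mul a b) := by
  have := D.leftMul_single κ a ∅ b
  rwa [Finset.sort_empty, leftMulWord_nil] at this

/-- The bimodule rules. -/
theorem leftMul_genMul (a : A) (j : Fin 3) (ω : Finset (Fin 3) → A) :
    D.leftMul κ a (genMul j ω) = ∑ i, genMul i (D.leftMul κ (D.M κ i j a) ω) := by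
  rw [← Finset.univ_sum_single ω]
  simp only [map_sum]
  rw [Finset.sum_comm]
  refine Finset.sum_congr rfl fun J _ => ?_
  have h := congrArg (fun F => F a (ω J))
    (foldr_sort (D.moveThrough_anticomm κ) (D.mul.compr₂ inc) j J)
  simp only [moveThrough_apply] at h
  simp only [leftMul_single, leftMulWord, genMul_single]
  rw [h]
  split_ifs with hj
  · simp
  · simp [leftMul_single, leftMulWord]

theorem leftMul_mul (a b : A) (ω : Finset (Fin 3) → A) :
    D.leftMul κ (D.mul a b) ω = D.leftMul κ a (D.leftMul κ b ω) := by
  induction ω using forms_induction generalizing a b with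
  | hinc c => simp only [leftMul_inc, D.mul_assoc]
  | hadd ω η hω hη => simp only [map_add, hω, hη]
  | hgen j ω ih =>
    simp only [leftMul_genMul, map_sum, M_mul, LinearMap.sum_apply, ih]
    rw [Finset.sum_comm]

/-! ### The product of forms -/

/-- The product of forms. -/
def wedge : (Finset (Fin 3) → A) →ₗ[ℂ] (Finset (Fin 3) → A) →ₗ[ℂ] (Finset (Fin 3) → A) :=
  ∑ I : Finset (Fin 3), (D.leftMul κ ∘ₗ LinearMap.proj I).compr₂ (wordMul (I.sort (· ≤ ·)))

theorem wedge_apply (ω η : Finset (Fin 3) → A) :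
    D.wedge κ ω η =
      ∑ I : Finset (Fin 3), wordMul (I.sort (· ≤ ·)) (D.leftMul κ (ω I) η) := by
  simp [wedge, LinearMap.sum_apply]

theorem wedge_single (I : Finset (Fin 3)) (a : A) (η : Finset (Fin 3) → A) :
    D.wedge κ (Pi.single I a) η = wordMul (I.sort (· ≤ ·)) (D.leftMul κ a η) := by
  rw [wedge_apply, Finset.sum_eq_single I]
  · simp
  · intro J _ hJ
    simp [hJ]
  · simp

theorem wedge_inc (a : A) (η : Finset (Fin 3) → A) : D.wedge κ (inc a) η = D.leftMul κ a η := by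
  have := D.wedge_single κ ∅ a η
  rwa [Finset.sort_empty, wordMul_nil] at this

theorem wedge_genMul (i : Fin 3) (ω η : Finset (Fin 3) → A) :
    D.wedge κ (genMul i ω) η = genMul i (D.wedge κ ω η) := by
  rw [← Finset.univ_sum_single ω]
  simp only [map_sum, LinearMap.sum_apply]
  refine Finset.sum_congr rfl fun J _ => ?_
  rw [wedge_single, genMul_wordMul_sort, genMul_single]
  split_ifs with hj
  · simp
  · simp [wedge_single]

theorem wedge_wordMul (l : List (Fin 3)) (ω η : Finset (Fin 3) → A) :
    D.wedge κ (wordMul l ω) η = wordMul l (D.wedge κ ω η) := by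
  induction l with
  | nil => rfl
  | cons i l ih => rw [wordMul_cons, wedge_genMul, ih, wordMul_cons]

theorem wedge_leftMul (a : A) (ω η : Finset (Fin 3) → A) :
    D.wedge κ (D.leftMul κ a ω) η = D.leftMul κ a (D.wedge κ ω η) := by
  induction ω using forms_induction generalizing a with
  | hinc c => rw [leftMul_inc, wedge_inc, wedge_inc, leftMul_mul]
  | hadd ω η hω hη => simp only [map_add, LinearMap.add_apply, hω, hη]
  | hgen j ω ih =>
    simp only [leftMul_genMul, map_sum, LinearMap.sum_apply, wedge_genMul, ih]

theorem wedge_assoc (ω η ζ : Finset (Fin 3) → A) :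
    D.wedge κ (D.wedge κ ω η) ζ = D.wedge κ ω (D.wedge κ η ζ) := by
  induction ω using forms_induction with
  | hinc c => rw [wedge_inc, wedge_inc, wedge_leftMul]
  | hadd ω η hω hη => simp only [map_add, LinearMap.add_apply, hω, hη]
  | hgen j ω ih => simp only [wedge_genMul, ih]

/-! ### The exterior derivative -/

/-- The exterior derivative. -/
def d : (Finset (Fin 3) → A) →ₗ[ℂ] (Finset (Fin 3) → A) :=
  ∑ i, genMul i ∘ₗ mapCoeff (D.partialD κ i)

theorem d_apply (ω : Finset (Fin 3) → A) :
    D.d κ ω = ∑ i, genMul i (mapCoeff (D.partialD κ i) ω) := by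
  simp [d, LinearMap.sum_apply]

theorem d_inc (a : A) : D.d κ (inc a) = ∑ i, genMul i (inc (D.partialD κ i a)) := by
  simp only [d_apply, mapCoeff_inc]

theorem d_genMul (j : Fin 3) (ω : Finset (Fin 3) → A) :
    D.d κ (genMul j ω) = -genMul j (D.d κ ω) := by
  simp only [d_apply, mapCoeff_genMul, map_sum, ← Finset.sum_neg_distrib]
  exact Finset.sum_congr rfl fun i _ => genMul_anticomm i j _

theorem d_wordMul (l : List (Fin 3)) (ω : Finset (Fin 3) → A) :
    D.d κ (wordMul l ω) = ((-1 : ℂ) ^ l.length) • wordMul l (D.d κ ω) := by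
  induction l with
  | nil => simp
  | cons j l ih => simp [d_genMul, ih, pow_succ]

/-- A double sum symmetric in the partial derivatives and antisymmetric in the generators equals its
own negative. -/
theorem d_d (ω : Finset (Fin 3) → A) : D.d κ (D.d κ ω) = 0 := by
  apply eq_zero_of_eq_neg
  have h : D.d κ (D.d κ ω) = ∑ i, ∑ j, genMul i (genMul j
      (mapCoeff (D.partialD κ i) (mapCoeff (D.partialD κ j) ω))) := by
    simp only [d_apply, map_sum, mapCoeff_genMul]
    exact Finset.sum_comm
  rw [h]
  nth_rewrite 2 [Finset.sum_comm]
  simp only [← Finset.sum_neg_distrib]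
  refine Finset.sum_congr rfl fun i _ => Finset.sum_congr rfl fun j _ => ?_
  rw [genMul_anticomm]
  congr 3
  ext I
  exact D.partialD_comm κ i j (ω I)

theorem wedge_d_inc (a : A) (ω : Finset (Fin 3) → A) :
    D.wedge κ (D.d κ (inc a)) ω = ∑ i, genMul i (D.leftMul κ (D.partialD κ i a) ω) := by
  simp only [d_inc, map_sum, LinearMap.sum_apply, wedge_genMul, wedge_inc]

/-- The Leibniz rule. -/
theorem d_leftMul (hκ : κ ≠ 0) (a : A) (ω : Finset (Fin 3) → A) :
    D.d κ (D.leftMul κ a ω) = D.wedge κ (D.d κ (inc a)) ω + D.leftMul κ a (D.d κ ω) := by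
  induction ω using forms_induction generalizing a with
  | hinc b =>
    rw [wedge_d_inc]
    simp only [leftMul_inc, d_inc, map_sum, leftMul_genMul, D.partialD_mul κ hκ,
      map_add, Finset.sum_add_distrib]
    congr 1
    rw [Finset.sum_comm]
  | hadd ω η hω hη =>
    simp only [map_add, hω, hη]
    abel
  | hgen j ω ih =>
    simp only [leftMul_genMul, map_sum, d_genMul, ih, wedge_d_inc, map_neg, map_add, neg_add,
      Finset.sum_add_distrib, Finset.sum_neg_distrib]
    congr 1
    rw [Finset.sum_comm, ← Finset.sum_neg_distrib]
    refine Finset.sum_congr rfl fun i _ => ?_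
    rw [← Finset.sum_neg_distrib]
    refine Finset.sum_congr rfl fun k _ => ?_
    rw [genMul_anticomm, neg_neg, partialD_M]

theorem d_inc_mul (hκ : κ ≠ 0) (a b : A) :
    D.d κ (inc (D.mul a b)) = D.wedge κ (D.d κ (inc a)) (inc b) + D.leftMul κ a (D.d κ (inc b)) := by
  rw [← leftMul_inc D κ, d_leftMul D κ hκ]

/-- The product of an exact one-form and a closed form is exact. -/
theorem wedge_d_inc_of_closed (hκ : κ ≠ 0) (a : A) {ω : Finset (Fin 3) → A} (hω : D.d κ ω = 0) :
    D.wedge κ (D.d κ (inc a)) ω = D.d κ (D.leftMul κ a ω) := by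
  rw [d_leftMul D κ hκ, hω, map_zero, add_zero]

/-! ### Degrees -/

theorem hasDegree_leftMul {k : ℕ} (a : A) {ω : Finset (Fin 3) → A} (hω : HasDegree k ω) :
    HasDegree k (D.leftMul κ a ω) := by
  refine hω.induction (p := fun ω => HasDegree k (D.leftMul κ a ω)) ?_ ?_ ?_
  · simpa using HasDegree.zero k
  · intro ω η hω hη
    simpa using hω.add hη
  · rintro l b rfl
    clear hω
    induction l generalizing a with
    | nil =>
      rw [wordMul_nil, leftMul_inc]
      exact hasDegree_inc _
    | cons j l ih =>
      rw [wordMul_cons, leftMul_genMul]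
      exact HasDegree.sum fun i => (ih _).genMul i

theorem hasDegree_wedge {k l : ℕ} {ω η : Finset (Fin 3) → A} (hω : HasDegree k ω)
    (hη : HasDegree l η) : HasDegree (l + k) (D.wedge κ ω η) := by
  refine hω.induction (p := fun ω => HasDegree (l + k) (D.wedge κ ω η)) ?_ ?_ ?_
  · simpa using HasDegree.zero _
  · intro ω η hω hη
    simpa using hω.add hη
  · rintro w a rfl
    rw [wedge_wordMul, wedge_inc]
    exact (D.hasDegree_leftMul κ a hη).wordMul w

theorem hasDegree_d_inc (a : A) : HasDegree 1 (D.d κ (inc a)) := by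
  rw [d_inc]
  exact HasDegree.sum fun i => (hasDegree_inc _).genMul i

/-! ### The twist -/

theorem mapCoeff_E_leftMul (a : A) (ω : Finset (Fin 3) → A) :
    mapCoeff D.E (D.leftMul κ a ω) = D.leftMul κ (D.E a) (mapCoeff D.E ω) := by
  induction ω using forms_induction generalizing a with
  | hinc c => simp only [leftMul_inc, mapCoeff_inc, D.E_mul]
  | hadd ω η hω hη => simp only [map_add, hω, hη]
  | hgen j ω ih => simp only [leftMul_genMul, map_sum, mapCoeff_genMul, ih, E_M]

theorem mapCoeff_E_wedge (ω η : Finset (Fin 3) → A) :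
    mapCoeff D.E (D.wedge κ ω η) = D.wedge κ (mapCoeff D.E ω) (mapCoeff D.E η) := by
  induction ω using forms_induction with
  | hinc c => simp only [wedge_inc, mapCoeff_inc, mapCoeff_E_leftMul]
  | hadd ω η hω hη => simp only [map_add, LinearMap.add_apply, hω, hη]
  | hgen j ω ih => simp only [wedge_genMul, mapCoeff_genMul, ih]

theorem mapCoeff_E_d_inc (a : A) : mapCoeff D.E (D.d κ (inc a)) = D.d κ (inc (D.E a)) := by
  simp only [d_inc, map_sum, mapCoeff_genMul, mapCoeff_inc, E_partialD]

/-! ### The integral -/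

/-- The integral of a form. -/
def int : (Finset (Fin 3) → A) →ₗ[ℂ] ℂ := D.tr ∘ₗ LinearMap.proj Finset.univ

theorem int_apply (ω : Finset (Fin 3) → A) : D.int ω = D.tr (ω Finset.univ) := rfl

/-- The Levi-Civita symbol. -/
def leviCivita (i j k : Fin 3) : ℤ :=
  genSign i Finset.univ * (genSign j (Finset.univ.erase i) *
    genSign k ((Finset.univ.erase i).erase j))

theorem int_genMul_genMul_genMul_inc (i j k : Fin 3) (a : A) :
    D.int (genMul i (genMul j (genMul k (inc a)))) = (leviCivita i j k : ℂ) * D.tr a := by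
  by_cases h : ((Finset.univ.erase i).erase j).erase k = (∅ : Finset (Fin 3))
  · simp [int_apply, genMul_apply, h, inc, leviCivita, _root_.mul_assoc]
  · have h0 : leviCivita i j k = 0 := by
      revert i j k
      decide
    simp [int_apply, genMul_apply, h, inc, h0]

theorem int_mapCoeff_E (ω : Finset (Fin 3) → A) : D.int (mapCoeff D.E ω) = D.int ω := by
  rw [int_apply, mapCoeff_apply, D.tr_E, int_apply]

theorem int_d (ω : Finset (Fin 3) → A) : D.int (D.d κ ω) = 0 := by
  simp [d_apply, int_apply, genMul_apply, mapCoeff_apply, tr_partialD]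

/-! ### Integration by parts under the twisted trace -/

theorem tr_E_mul (a b : A) : D.tr (D.mul (D.E a) b) = D.tr (D.mul b a) := (D.tr_mul b a).symm

theorem tr_mul_Einv (a b : A) : D.tr (D.mul a (D.Einv b)) = D.tr (D.mul (D.E a) b) := by
  rw [← D.tr_E, D.E_mul, D.E_Einv]

theorem tr_mul_E (a b : A) : D.tr (D.mul a (D.E b)) = D.tr (D.mul (D.Einv a) b) := by
  rw [← D.tr_E (D.mul (D.Einv a) b), D.E_mul, D.E_Einv]

theorem tr_mul_P (a b : A) : D.tr (D.mul a (D.P b)) = -D.tr (D.mul (D.Einv (D.P a)) b) := by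
  have h := D.tr_P (D.mul (D.Einv a) b)
  rw [D.P_mul, D.E_Einv, map_add, D.P_Einv] at h
  exact eq_neg_of_add_eq_zero_right h

/-- Functions commute with dx ∧ ψ₊ ∧ ψ₋: moving one through the three generators applies the
determinant of `M`, whose only nonzero term is the diagonal one, id · `Einv` · `E` = id. What
remains is the twisted trace property of `tr`. -/
theorem trace_zero_three (a : A) {η : Finset (Fin 3) → A} (hη : HasDegree 3 η) :
    D.int (D.wedge κ (inc a) η) = D.int (D.wedge κ (mapCoeff D.E η) (inc a)) := by
  rw [wedge_inc]
  refine hη.induction (p := fun η => D.int (D.leftMul κ a η) =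
    D.int (D.wedge κ (mapCoeff D.E η) (inc a))) (by simp) ?_ ?_
  · intro ω η hω hη
    simp only [map_add, LinearMap.add_apply, hω, hη]
  · intro l b hl
    obtain ⟨i, j, k, rfl⟩ := List.length_eq_three.1 hl
    simp only [wordMul_cons, wordMul_nil, mapCoeff_genMul, mapCoeff_inc, wedge_genMul, wedge_inc,
      leftMul_inc, leftMul_genMul, map_sum, int_genMul_genMul_genMul_inc, tr_E_mul]
    fin_cases i <;> fin_cases j <;> fin_cases k <;>
      simp +decide [Fin.sum_univ_three, M, leviCivita, genSign, D.E_Einv, D.Einv_E, D.P_E, D.P_Einv] <;>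
      ring

/-- By linearity both forms are words. In each of the 27 cases the two sides are traces of products
of two elements, and integration by parts moves all operators onto the first factor, where they
agree. -/
theorem trace_one_two {ω η : Finset (Fin 3) → A} (hω : HasDegree 1 ω) (hη : HasDegree 2 η) :
    D.int (D.wedge κ ω η) = D.int (D.wedge κ (mapCoeff D.E η) ω) := by
  refine hω.induction (p := fun ω => D.int (D.wedge κ ω η) =
    D.int (D.wedge κ (mapCoeff D.E η) ω)) (by simp) ?_ ?_
  · intro ω η hω hη
    simp only [map_add, LinearMap.add_apply, hω, hη]
  intro l a hl
  obtain ⟨i, rfl⟩ := List.length_eq_one_iff.1 hl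
  refine hη.induction (p := fun η => D.int (D.wedge κ (wordMul [i] (inc a)) η) =
    D.int (D.wedge κ (mapCoeff D.E η) (wordMul [i] (inc a)))) (by simp) ?_ ?_
  · intro ω η hω hη
    simp only [map_add, LinearMap.add_apply, hω, hη]
  intro l b hl
  obtain ⟨j, k, rfl⟩ := List.length_eq_two.1 hl
  simp only [wordMul_cons, wordMul_nil, mapCoeff_genMul, mapCoeff_inc, wedge_genMul, wedge_inc,
    leftMul_inc, leftMul_genMul, map_sum, int_genMul_genMul_genMul_inc, tr_E_mul, ← E_M]
  have h1 : ∀ x : ℂ, 2 * Complex.I / κ * (Complex.I / κ * x) = -(2 * ((κ : ℂ) ^ 2)⁻¹ * x) := by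
    intro x
    linear_combination (2 * ((κ : ℂ) ^ 2)⁻¹ * x) * Complex.I_sq
  have h2 : ∀ x : ℂ, Complex.I / κ * (2 * Complex.I / κ * x) = -(2 * ((κ : ℂ) ^ 2)⁻¹ * x) := by
    intro x
    linear_combination (2 * ((κ : ℂ) ^ 2)⁻¹ * x) * Complex.I_sq
  fin_cases i <;> fin_cases j <;> fin_cases k <;>
    simp +decide [Fin.sum_univ_three, M, leviCivita, genSign, D.E_Einv, D.Einv_E, D.P_E, D.P_Einv,
      tr_mul_Einv, tr_mul_E, tr_mul_P, h1, h2] <;>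
    ring

theorem trace (k l : ℕ) {ω η : Finset (Fin 3) → A} (hkl : k + l = 3) (hω : HasDegree k ω)
    (hη : HasDegree l η) :
    D.int (D.wedge κ ω η) = (-1) ^ (k * l) * D.int (D.wedge κ (mapCoeff D.E η) ω) := by
  have hE : ∀ {k : ℕ} {ω : Finset (Fin 3) → A}, HasDegree k ω → HasDegree k (mapCoeff D.E ω) :=
    fun h I hI => by rw [mapCoeff_apply, h I hI, map_zero]
  have hinc : ∀ {ω : Finset (Fin 3) → A}, HasDegree 0 ω → ω = inc (ω ∅) := fun {ω} h => by
    ext I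
    by_cases hI : I = ∅
    · simp [hI, inc]
    · rw [h I (by simpa using hI)]
      simp [inc, hI]
  have hinv := fun ω η : Finset (Fin 3) → A => D.int_mapCoeff_E (D.wedge κ ω η)
  simp only [mapCoeff_E_wedge] at hinv
  obtain rfl : l = 3 - k := by omega
  have hk : k ≤ 3 := by omega
  interval_cases k
  · rw [hinc hω, trace_zero_three D κ _ hη]
    simp
  · rw [trace_one_two D κ hω hη]
    norm_num
  -- Twisting both factors leaves the integral unchanged; bidegree (1, 2) applied to the twisted η
  -- and to ω, read backwards, then gives this case.
  · rw [← hinv, ← trace_one_two D κ (hE hη) hω]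
    norm_num
  · rw [← hinv, hinc (hE hη), ← trace_zero_three D κ _ hω]
    simp

/-! ### The cyclic cocycle -/

/-- The functional `∫ f₀ df₁ ∧ df₂ ∧ df₃`. -/
def cocycle (a b c e : A) : ℂ :=
  D.int (D.wedge κ (D.wedge κ (D.leftMul κ a (D.d κ (inc b))) (D.d κ (inc c))) (D.d κ (inc e)))

/-- The trace property moves de to the front as d(`E e`). Since db ∧ dc is closed, Stokes for `E e`
· a db ∧ dc then moves d from `E e` to a, at the cost of a sign. -/
theorem cocycle_cyclic (hκ : κ ≠ 0) (a b c e : A) :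
    D.cocycle κ a b c e = -D.cocycle κ (D.E e) a b c := by
  have hd : ∀ x : A, D.d κ (D.d κ (inc x)) = 0 := fun x => D.d_d κ _
  have hdeg : HasDegree 2 (D.wedge κ (D.leftMul κ a (D.d κ (inc b))) (D.d κ (inc c))) :=
    D.hasDegree_wedge κ (D.hasDegree_leftMul κ a (D.hasDegree_d_inc κ b)) (D.hasDegree_d_inc κ c)
  have hclosed : D.d κ (D.wedge κ (D.d κ (inc b)) (D.d κ (inc c))) = 0 := by
    rw [wedge_d_inc_of_closed D κ hκ b (hd c), d_d]
  have h := D.int_d κ (D.leftMul κ (D.E e)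
    (D.wedge κ (D.leftMul κ a (D.d κ (inc b))) (D.d κ (inc c))))
  rw [d_leftMul D κ hκ, map_add, wedge_leftMul, d_leftMul D κ hκ, hclosed, map_zero,
    add_zero] at h
  rw [cocycle, D.trace κ 2 1 rfl hdeg (D.hasDegree_d_inc κ e), mapCoeff_E_d_inc, wedge_leftMul,
    eq_neg_of_add_eq_zero_left h, cocycle, wedge_leftMul, wedge_leftMul, wedge_assoc]
  norm_num

/-- Expanding d(bc), d(ce) and d(ef) by Leibniz, all terms cancel in pairs except -∫ (a db ∧ dc ∧
de) f and ∫ `E f` · a db ∧ dc ∧ de, which cancel by the trace property. -/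
theorem cocycle_coboundary (hκ : κ ≠ 0) (a b c e f : A) :
    D.cocycle κ (D.mul a b) c e f - D.cocycle κ a (D.mul b c) e f +
      D.cocycle κ a b (D.mul c e) f - D.cocycle κ a b c (D.mul e f) +
      D.cocycle κ (D.mul (D.E f) a) b c e = 0 := by
  have hdeg : HasDegree 3 (D.wedge κ (D.wedge κ (D.leftMul κ a (D.d κ (inc b))) (D.d κ (inc c)))
      (D.d κ (inc e))) :=
    D.hasDegree_wedge κ (D.hasDegree_wedge κ (D.hasDegree_leftMul κ a (D.hasDegree_d_inc κ b))
      (D.hasDegree_d_inc κ c)) (D.hasDegree_d_inc κ e)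
  have ht := D.trace κ 3 0 rfl hdeg (hasDegree_inc f)
  rw [mapCoeff_inc] at ht
  simp only [← wedge_inc, wedge_assoc] at ht
  simp only [cocycle, D.d_inc_mul κ hκ, leftMul_mul, map_add, LinearMap.add_apply]
  simp only [← wedge_inc, wedge_assoc, ht]
  ring

end KappaCalculus

/-! ### The calculus over the test functions -/

theorem expMul_add (γ : ℝ) (φ ψ : Fn) : expMul γ (φ + ψ) = expMul γ φ + expMul γ ψ := by
  ext q
  simp [expMul, mul_add]

theorem expMul_smul (γ : ℝ) (c : ℂ) (φ : Fn) : expMul γ (c • φ) = c • expMul γ φ := by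
  ext q
  simp only [expMul, Pi.smul_apply, smul_eq_mul]
  ring

theorem expMul_expMul_of_add_eq_zero {γ δ : ℝ} (h : γ + δ = 0) (φ : Fn) :
    expMul γ (expMul δ φ) = φ := by
  ext q
  simp only [expMul]
  rw [← mul_assoc, ← Complex.ofReal_mul, ← Real.exp_add, ← add_mul, h]
  simp

theorem expMul_conv (κ γ : ℝ) (φ ψ : Fn) :
    expMul γ (conv κ φ ψ) = conv κ (expMul γ φ) (expMul γ ψ) := by
  ext p
  simp only [conv, convKernel, expMul]
  rw [mul_left_comm, ← integral_const_mul]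
  congr 2 with q
  have h : Real.exp (γ * p.1) = Real.exp (γ * q.1) * Real.exp (γ * (p.1 - q.1)) := by
    rw [← Real.exp_add]
    ring_nf
  rw [h, Complex.ofReal_mul]
  ring

/-- The second coordinate of a group product splits as c = (c - exp(u/κ) b) + exp(u/κ) b; the two
summands give the two terms. -/
theorem coordMul_conv (κ : ℝ) {φ ψ : Fn} (hφ : φ ∈ TestFn) (hψ : ψ ∈ TestFn) :
    coordMul (conv κ φ ψ) =
      conv κ (coordMul φ) ψ + conv κ (expMul (1 / κ) φ) (coordMul ψ) := by
  ext p
  simp only [conv, Pi.add_apply, coordMul]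
  rw [← mul_add, ← integral_add (integrable_convKernel κ (coordMul_mem hφ) hψ p)
    (integrable_convKernel κ (expMul_mem _ hφ) (coordMul_mem hψ) p), mul_left_comm,
    ← integral_const_mul]
  congr 2 with q
  simp only [convKernel, coordMul, expMul, one_div_mul_eq_div]
  push_cast
  ring

/-- At the identity the two arguments of the kernel are mutually inverse group elements. The
substitution u ↦ -u, b ↦ -exp(u/κ) b exchanges their roles, and its Jacobian exp(u/κ) is the twist.
-/
theorem conv_zero_comm (κ : ℝ) {φ ψ : Fn} (hφ : φ ∈ TestFn) (hψ : ψ ∈ TestFn) :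
    conv κ φ ψ 0 = conv κ (expMul (1 / κ) ψ) φ 0 := by
  have h1 : ∫ q, convKernel κ φ ψ (0, q) = ∫ u : ℝ, ∫ b : ℝ, convKernel κ φ ψ (0, (u, b)) :=
    integral_prod _ (integrable_convKernel κ hφ hψ 0)
  have h2 : ∫ q, convKernel κ (expMul (1 / κ) ψ) φ (0, q) =
      ∫ u : ℝ, ∫ b : ℝ, convKernel κ (expMul (1 / κ) ψ) φ (0, (u, b)) :=
    integral_prod _ (integrable_convKernel κ (expMul_mem _ hψ) hφ 0)
  rw [conv, conv, h1, h2, ← integral_neg_eq_self]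
  congr 2 with u
  have h3 := Measure.integral_comp_mul_left (fun b : ℝ => convKernel κ φ ψ (0, (-u, b)))
    (-Real.exp (u / κ))
  rw [abs_inv, abs_neg, abs_of_pos (Real.exp_pos _)] at h3
  have h4 : ∫ b : ℝ, convKernel κ φ ψ (0, (-u, b)) = Real.exp (u / κ) •
      ∫ b : ℝ, convKernel κ φ ψ (0, (-u, -Real.exp (u / κ) * b)) := by
    rw [h3, smul_inv_smul₀ (Real.exp_pos _).ne']
  rw [h4, ← integral_smul]
  congr 1 with b
  simp only [convKernel, expMul, Prod.fst_zero, Prod.snd_zero, one_div_mul_eq_div]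
  have h5 : 0 - Real.exp (-u / κ) * (-Real.exp (u / κ) * b) = b := by
    rw [neg_mul, mul_neg, ← mul_assoc, ← Real.exp_add, neg_div, neg_add_cancel]
    simp
  rw [h5, Complex.real_smul, zero_sub, zero_sub, neg_neg, zero_sub, neg_mul]
  ring

/-- Multiplication by `exp (γ u)` on the test functions. -/
def expMulL (γ : ℝ) : TestFn →ₗ[ℂ] TestFn where
  toFun φ := ⟨expMul γ φ, expMul_mem γ φ.2⟩
  map_add' φ ψ := Subtype.ext (expMul_add γ φ ψ)
  map_smul' c φ := Subtype.ext (expMul_smul γ c φ)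

/-- Multiplication by `-i v` on the test functions. -/
def coordMulL : TestFn →ₗ[ℂ] TestFn where
  toFun φ := ⟨coordMul φ, coordMul_mem φ.2⟩
  map_add' φ ψ := Subtype.ext (by ext q; simp [coordMul, mul_add])
  map_smul' c φ := Subtype.ext (by
    ext q
    simp only [coordMul, Submodule.coe_smul, Pi.smul_apply, smul_eq_mul, RingHom.id_apply]
    ring)

/-- The convolution of test functions. -/
def convL (κ : ℝ) : TestFn →ₗ[ℂ] TestFn →ₗ[ℂ] TestFn :=
  LinearMap.mk₂ ℂ (fun φ ψ => ⟨conv κ φ ψ, conv_mem κ φ.2 ψ.2⟩)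
    (fun φ φ' ψ => Subtype.ext (add_conv κ φ.2 φ'.2 ψ.2))
    (fun c φ ψ => Subtype.ext (smul_conv κ c φ ψ))
    (fun φ ψ ψ' => Subtype.ext (conv_add κ φ.2 ψ.2 ψ'.2))
    (fun c φ ψ => Subtype.ext (conv_smul κ c φ ψ))

/-- The calculus over the convolution algebra of test functions. -/
def testCalculus (κ : ℝ) : KappaCalculus TestFn where
  mul := convL κ
  E := expMulL (1 / κ)
  Einv := expMulL (-(1 / κ))
  P := coordMulL
  tr := (2 * Real.pi : ℂ) • (LinearMap.proj (0 : ℝ × ℝ) ∘ₗ TestFn.subtype)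
  mul_assoc a b c := Subtype.ext (conv_assoc κ a.2 b.2 c.2)
  E_Einv a := Subtype.ext (expMul_expMul_of_add_eq_zero (add_neg_cancel _) _)
  Einv_E a := Subtype.ext (expMul_expMul_of_add_eq_zero (neg_add_cancel _) _)
  P_E a := Subtype.ext (by
    ext q
    simp only [expMulL, coordMulL, LinearMap.coe_mk, AddHom.coe_mk, expMul, coordMul]
    ring)
  E_mul a b := Subtype.ext (expMul_conv κ _ a b)
  P_mul a b := Subtype.ext (coordMul_conv κ a.2 b.2)
  tr_E a := by simp [expMulL, expMul]
  tr_P a := by simp [coordMulL, coordMul]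
  tr_mul a b := congrArg (fun x : ℂ => (2 * Real.pi : ℂ) * x) (conv_zero_comm κ a.2 b.2)

/-! ### The Fourier transform of forms -/

/-- The Fourier transform of test functions. -/
def fourierL : TestFn →ₗ[ℂ] Fn where
  toFun φ := fourier φ
  map_add' φ ψ := by
    ext p
    simp only [fourier, Submodule.coe_add, Pi.add_apply, add_mul]
    rw [integral_add (integrable_fourier φ.2.1 φ.2.2 p) (integrable_fourier ψ.2.1 ψ.2.2 p), mul_add]
  map_smul' c φ := by
    ext p
    simp only [fourier, Submodule.coe_smul, Pi.smul_apply, smul_eq_mul, mul_assoc,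
      integral_const_mul, RingHom.id_apply]
    ring

theorem mem_B_iff {f : Fn} : f ∈ B ↔ ∃ φ, fourierL φ = f :=
  ⟨fun ⟨φ, h, hc, hf⟩ => ⟨⟨φ, h, hc⟩, hf.symm⟩, fun ⟨φ, hφ⟩ => ⟨φ, φ.2.1, φ.2.2, hφ.symm⟩⟩

theorem fourierL_mem (φ : TestFn) : fourierL φ ∈ B := mem_B_iff.2 ⟨φ, rfl⟩

section Transform

variable (κ : ℝ)

theorem starMul_fourierL (a b : TestFn) :
    starMul κ (fourierL a) (fourierL b) = fourierL ((testCalculus κ).mul a b) :=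
  starMul_fourier κ a.2 b.2

theorem E_fourierL (a : TestFn) : E κ (fourierL a) = fourierL ((testCalculus κ).E a) :=
  T_fourier _ a.2

theorem T_fourierL (a : TestFn) : T (1 / κ) (fourierL a) = fourierL ((testCalculus κ).E a) :=
  T_fourier _ a.2

theorem Einv_fourierL (a : TestFn) : Einv κ (fourierL a) = fourierL ((testCalculus κ).Einv a) :=
  T_fourier _ a.2

theorem P_fourierL (a : TestFn) : P (fourierL a) = fourierL ((testCalculus κ).P a) :=
  P_fourier a.2

theorem bimod_fourierL (a : TestFn) (i j : Fin 3) :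
    bimod κ (fourierL a) i j = fourierL ((testCalculus κ).M κ i j a) := by
  fin_cases i <;> fin_cases j <;>
    simp [bimod, KappaCalculus.M, P_fourierL κ, Einv_fourierL, E_fourierL]

theorem dComp_fourierL (a : TestFn) (i : Fin 3) :
    dComp κ (fourierL a) i = fourierL ((testCalculus κ).partialD κ i a) := by
  fin_cases i <;>
    simp [dComp, KappaCalculus.partialD, P_fourierL κ, Einv_fourierL, E_fourierL]

/-- The Fourier transform of forms. -/
def fourierForm : (Finset (Fin 3) → TestFn) →ₗ[ℂ] Form := fourierL.compLeft _

theorem fourierForm_apply (ω : Finset (Fin 3) → TestFn) (I : Finset (Fin 3)) :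
    fourierForm ω I = fourierL (ω I) := rfl

theorem ofFn_fourierL (a : TestFn) : ofFn (fourierL a) = fourierForm (inc a) := by
  funext I
  by_cases hI : I = ∅
  · subst hI
    simp [fourierForm_apply, ofFn, inc]
  · simp [fourierForm_apply, ofFn, inc, hI]

theorem genWedge_fourierForm (i : Fin 3) (ω : Finset (Fin 3) → TestFn) :
    genWedge i (fourierForm ω) = fourierForm (genMul i ω) := by
  funext K
  rw [genWedge, fourierForm_apply, fourierForm_apply, genMul_apply, genSign]
  split_ifs
  · rw [map_zsmul, ← Int.cast_smul_eq_zsmul ℂ]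
    push_cast
    rfl
  · simp

theorem listWedge_fourierForm (l : List (Fin 3)) (ω : Finset (Fin 3) → TestFn) :
    listWedge l (fourierForm ω) = fourierForm (wordMul l ω) := by
  induction l with
  | nil => rfl
  | cons i l ih => rw [wordMul_cons, ← genWedge_fourierForm, ← ih, listWedge, listWedge,
      List.foldr_cons]

theorem leftMulList_fourierL (l : List (Fin 3)) (a b : TestFn) :
    leftMulList κ l (fourierL a) (fourierL b) =
      fourierForm ((testCalculus κ).leftMulWord κ l a b) := by
  induction l generalizing a with
  | nil => rw [leftMulList, starMul_fourierL, ofFn_fourierL, KappaCalculus.leftMulWord_nil]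
  | cons j l ih =>
    simp only [leftMulList, bimod_fourierL, ih, genWedge_fourierForm,
      KappaCalculus.leftMulWord_cons, map_sum]

theorem leftMul_fourierForm (a : TestFn) (ω : Finset (Fin 3) → TestFn) :
    leftMul κ (fourierL a) (fourierForm ω) = fourierForm ((testCalculus κ).leftMul κ a ω) := by
  simp only [leftMul, KappaCalculus.leftMul_apply, map_sum, fourierForm_apply,
    leftMulList_fourierL]

theorem wedge_fourierForm (ω η : Finset (Fin 3) → TestFn) :
    wedge κ (fourierForm ω) (fourierForm η) = fourierForm ((testCalculus κ).wedge κ ω η) := by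
  simp only [wedge, KappaCalculus.wedge_apply, map_sum, fourierForm_apply, leftMul_fourierForm,
    listWedge_fourierForm]

/-- `KappaCalculus.d` puts the new generator in front, while `d` puts it behind the word e I with
the sign (-1)^|I|; `d_wordMul` reconciles the two. -/
theorem d_fourierForm (ω : Finset (Fin 3) → TestFn) :
    d κ (fourierForm ω) = fourierForm ((testCalculus κ).d κ ω) := by
  have h : (testCalculus κ).d κ ω = ∑ I : Finset (Fin 3), ((-1 : ℂ) ^ I.card) •
      wordMul (I.sort (· ≤ ·)) (∑ i, genMul i (inc ((testCalculus κ).partialD κ i (ω I)))) := by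
    conv_lhs => rw [← sum_wordMul ω]
    simp only [map_sum, KappaCalculus.d_wordMul, Finset.length_sort, KappaCalculus.d_inc]
  simp only [d, fourierForm_apply, dComp_fourierL, ofFn_fourierL, genWedge_fourierForm, ← map_sum,
    listWedge_fourierForm]
  rw [h]
  simp only [map_sum, map_smul]

theorem twist_fourierForm (ω : Finset (Fin 3) → TestFn) :
    twist κ (fourierForm ω) = fourierForm (mapCoeff (testCalculus κ).E ω) := by
  funext I
  exact T_fourierL κ (ω I)

theorem integral_fourierForm (ω : Finset (Fin 3) → TestFn) :
    integral (fourierForm ω) = (testCalculus κ).int ω :=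
  integral_fourier (ω Finset.univ).2

theorem cochain_fourierL (a : Fin 4 → TestFn) :
    cochain κ (fun i => fourierL (a i)) = (testCalculus κ).cocycle κ (a 0) (a 1) (a 2) (a 3) := by
  simp only [cochain, ofFn_fourierL, d_fourierForm, leftMul_fourierForm, wedge_fourierForm,
    integral_fourierForm κ, KappaCalculus.cocycle]

theorem IsForm.exists_fourierForm {k : ℕ} {ω : Form} (h : IsForm k ω) :
    ∃ ω' : Finset (Fin 3) → TestFn, HasDegree k ω' ∧ fourierForm ω' = ω := by
  choose g hg using fun I => mem_B_iff.1 (h I).1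
  -- The chosen preimage of a zero coefficient need not be known to vanish, so it is replaced by 0
  -- outside degree k.
  refine ⟨fun I => if I.card = k then g I else 0, fun I hI => if_neg hI, ?_⟩
  funext I
  rw [fourierForm_apply]
  split_ifs with hI
  · exact hg I
  · rw [(h I).2 hI, map_zero]

end Transform

/-! ### Transfer of the claims to `B` -/

theorem isAlgebraOn_B (κ : ℝ) : IsAlgebraOn B (starMul κ) where
  mul_mem a ha b hb := by
    obtain ⟨a, rfl⟩ := mem_B_iff.1 ha
    obtain ⟨b, rfl⟩ := mem_B_iff.1 hb
    rw [starMul_fourierL]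
    exact fourierL_mem _
  assoc a ha b hb c hc := by
    obtain ⟨a, rfl⟩ := mem_B_iff.1 ha
    obtain ⟨b, rfl⟩ := mem_B_iff.1 hb
    obtain ⟨c, rfl⟩ := mem_B_iff.1 hc
    simp only [starMul_fourierL, KappaCalculus.mul_assoc]
  add_mul a ha b hb c hc := by
    obtain ⟨a, rfl⟩ := mem_B_iff.1 ha
    obtain ⟨b, rfl⟩ := mem_B_iff.1 hb
    obtain ⟨c, rfl⟩ := mem_B_iff.1 hc
    simp only [← map_add, starMul_fourierL, LinearMap.map_add₂]
  mul_add a ha b hb c hc := by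
    obtain ⟨a, rfl⟩ := mem_B_iff.1 ha
    obtain ⟨b, rfl⟩ := mem_B_iff.1 hb
    obtain ⟨c, rfl⟩ := mem_B_iff.1 hc
    simp only [← map_add, starMul_fourierL]
  smul_mul r a ha b hb := by
    obtain ⟨a, rfl⟩ := mem_B_iff.1 ha
    obtain ⟨b, rfl⟩ := mem_B_iff.1 hb
    simp only [← map_smul, starMul_fourierL, LinearMap.map_smul₂]
  mul_smul r a ha b hb := by
    obtain ⟨a, rfl⟩ := mem_B_iff.1 ha
    obtain ⟨b, rfl⟩ := mem_B_iff.1 hb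
    simp only [← map_smul, starMul_fourierL]

theorem isAutomorphismOn_B (κ : ℝ) : IsAutomorphismOn B (starMul κ) (T (1 / κ)) where
  bijOn := by
    refine Set.InvOn.bijOn (f' := T (-(1 / κ))) ⟨?_, ?_⟩ ?_ ?_
    · intro a ha
      obtain ⟨a, rfl⟩ := mem_B_iff.1 ha
      have := Einv_fourierL κ ((testCalculus κ).E a)
      rwa [KappaCalculus.Einv_E, ← T_fourierL] at this
    · intro a ha
      obtain ⟨a, rfl⟩ := mem_B_iff.1 ha
      have := T_fourierL κ ((testCalculus κ).Einv a)
      rwa [KappaCalculus.E_Einv, ← Einv_fourierL] at this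
    · intro a ha
      obtain ⟨a, rfl⟩ := mem_B_iff.1 ha
      rw [T_fourierL]
      exact fourierL_mem _
    · intro a ha
      obtain ⟨a, rfl⟩ := mem_B_iff.1 ha
      have := Einv_fourierL κ a
      rw [Einv] at this
      rw [this]
      exact fourierL_mem _
  map_add a ha b hb := by
    obtain ⟨a, rfl⟩ := mem_B_iff.1 ha
    obtain ⟨b, rfl⟩ := mem_B_iff.1 hb
    simp only [← map_add, T_fourierL]
  map_smul r a ha := by
    obtain ⟨a, rfl⟩ := mem_B_iff.1 ha
    simp only [← map_smul, T_fourierL]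
  map_mul a ha b hb := by
    obtain ⟨a, rfl⟩ := mem_B_iff.1 ha
    obtain ⟨b, rfl⟩ := mem_B_iff.1 hb
    simp only [T_fourierL, starMul_fourierL, KappaCalculus.E_mul]

theorem isClosedGradedTwistedTrace (κ : ℝ) : IsClosedGradedTwistedTrace κ where
  integrable f hf := by
    obtain ⟨φ, rfl⟩ := mem_B_iff.1 hf
    exact integrable_fourier_transform φ.2
  closed ω hω := by
    obtain ⟨ω, -, rfl⟩ := hω.exists_fourierForm
    rw [d_fourierForm, integral_fourierForm κ, KappaCalculus.int_d]
  trace k l ω η hkl hω hη := by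
    obtain ⟨ω, hω', rfl⟩ := hω.exists_fourierForm
    obtain ⟨η, hη', rfl⟩ := hη.exists_fourierForm
    rw [twist_fourierForm, wedge_fourierForm, wedge_fourierForm, integral_fourierForm κ,
      integral_fourierForm κ, KappaCalculus.trace _ κ k l hkl hω' hη']

theorem update_fourierL {ι : Type*} [DecidableEq ι] (a : ι → TestFn) (i : ι) (x : TestFn) :
    Function.update (fun j => fourierL (a j)) i (fourierL x) =
      fun j => fourierL (Function.update a i x j) :=
  (Function.comp_update (fun x => fourierL x) a i x).symm

theorem isTwistedCyclicCocycle (κ : ℝ) (hκ : κ ≠ 0) :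
    IsTwistedCyclicCocycle B (starMul κ) (T (1 / κ)) 3 (cochain κ) where
  map_add a ha i x hx y hy := by
    choose a' ha' using fun i => mem_B_iff.1 (ha i)
    obtain rfl : (fun i => fourierL (a' i)) = a := funext ha'
    obtain ⟨x, rfl⟩ := mem_B_iff.1 hx
    obtain ⟨y, rfl⟩ := mem_B_iff.1 hy
    simp only [← map_add, update_fourierL, cochain_fourierL]
    fin_cases i <;> simp [KappaCalculus.cocycle]
  map_smul a ha i r x hx := by
    choose a' ha' using fun i => mem_B_iff.1 (ha i)
    obtain rfl : (fun i => fourierL (a' i)) = a := funext ha'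
    obtain ⟨x, rfl⟩ := mem_B_iff.1 hx
    simp only [← map_smul, update_fourierL, cochain_fourierL]
    fin_cases i <;> simp [KappaCalculus.cocycle]
  cyclic a ha := by
    choose a' ha' using fun i => mem_B_iff.1 (ha i)
    obtain rfl : (fun i => fourierL (a' i)) = a := funext ha'
    have h : (Fin.cons (T (1 / κ) (fourierL (a' (Fin.last 3))))
        (fun i : Fin 3 => fourierL (a' i.castSucc)) : Fin 4 → Fn) =
        fun i => fourierL (![(testCalculus κ).E (a' 3), a' 0, a' 1, a' 2] i) := by
      funext i
      rw [T_fourierL]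
      fin_cases i <;> rfl
    rw [h, cochain_fourierL, cochain_fourierL, KappaCalculus.cocycle_cyclic _ κ hκ]
    norm_num
    rfl
  coboundary a ha := by
    choose a' ha' using fun i => mem_B_iff.1 (ha i)
    obtain rfl : (fun i => fourierL (a' i)) = a := funext ha'
    have h0 : (Fin.contractNth (0 : Fin 5) (starMul κ) fun i => fourierL (a' i)) = fun i =>
        fourierL (![(testCalculus κ).mul (a' 0) (a' 1), a' 2, a' 3, a' 4] i) := by
      funext i
      fin_cases i <;> simp [Fin.contractNth, starMul_fourierL]
    have h1 : (Fin.contractNth (1 : Fin 5) (starMul κ) fun i => fourierL (a' i)) = fun i =>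
        fourierL (![a' 0, (testCalculus κ).mul (a' 1) (a' 2), a' 3, a' 4] i) := by
      funext i
      fin_cases i <;> simp [Fin.contractNth, starMul_fourierL]
    have h2 : (Fin.contractNth (2 : Fin 5) (starMul κ) fun i => fourierL (a' i)) = fun i =>
        fourierL (![a' 0, a' 1, (testCalculus κ).mul (a' 2) (a' 3), a' 4] i) := by
      funext i
      fin_cases i <;> simp [Fin.contractNth, starMul_fourierL]
    have h3 : (Fin.contractNth (3 : Fin 5) (starMul κ) fun i => fourierL (a' i)) = fun i =>
        fourierL (![a' 0, a' 1, a' 2, (testCalculus κ).mul (a' 3) (a' 4)] i) := by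
      funext i
      fin_cases i <;> simp [Fin.contractNth, starMul_fourierL]
    have h4 : (Fin.cons (starMul κ (T (1 / κ) (fourierL (a' (Fin.last 4)))) (fourierL (a' 0)))
        (fun i : Fin 3 => fourierL (a' i.succ.castSucc)) : Fin 4 → Fn) = fun i => fourierL
        (![(testCalculus κ).mul ((testCalculus κ).E (a' 4)) (a' 0), a' 1, a' 2, a' 3] i) := by
      funext i
      rw [T_fourierL, starMul_fourierL]
      fin_cases i <;> rfl
    have h := (testCalculus κ).cocycle_coboundary κ hκ (a' 0) (a' 1) (a' 2) (a' 3) (a' 4)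
    have e0 := congrArg (cochain κ) h0
    have e1 := congrArg (cochain κ) h1
    have e2 := congrArg (cochain κ) h2
    have e3 := congrArg (cochain κ) h3
    have e4 := congrArg (cochain κ) h4
    rw [cochain_fourierL] at e0 e1 e2 e3 e4
    rw [twistedCoboundary]
    -- The summands match `e0` to `e4` by definitional unfolding of the `Fin` indices, so the sum is
    -- assembled from `congrArg` terms.
    refine (congrArg (· + _) (Fin.sum_univ_four _)).trans ?_
    refine Eq.trans (congrArg₂ (· + ·) (congrArg₂ (· + ·) (congrArg₂ (· + ·) (congrArg₂ (· + ·)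
      (congrArg (_ * ·) e0) (congrArg (_ * ·) e1)) (congrArg (_ * ·) e2)) (congrArg (_ * ·) e3))
      (congrArg (_ * ·) e4)) (Eq.trans ?_ h)
    simp
    ring

end KappaMinkowski

theorem mainTheorem2 (κ : ℝ) (hκ : 0 < κ) :
    KappaMinkowski.IsAlgebraOn KappaMinkowski.B (KappaMinkowski.starMul κ) ∧
    KappaMinkowski.IsAutomorphismOn KappaMinkowski.B (KappaMinkowski.starMul κ)
      (KappaMinkowski.T (1 / κ)) ∧
    KappaMinkowski.IsClosedGradedTwistedTrace κ ∧
    KappaMinkowski.IsTwistedCyclicCocycle KappaMinkowski.B (KappaMinkowski.starMul κ)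
      (KappaMinkowski.T (1 / κ)) 3 (KappaMinkowski.cochain κ) :=
  ⟨KappaMinkowski.isAlgebraOn_B κ, KappaMinkowski.isAutomorphismOn_B κ,
    KappaMinkowski.isClosedGradedTwistedTrace κ, KappaMinkowski.isTwistedCyclicCocycle κ hκ.ne'⟩

end
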